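/- For a finite set $A$ let $\Delta(A)$ be the set of probability distributions on $A$, and for a Borel set $\Theta$ in a Euclidean space let $\Delta(\Theta)$ be the set of Borel probability measures on $\Theta$. Let $\mathbb S$ (states) and $\mathbb X$ (actions) be nonempty finite sets, $\Gamma:\mathbb S\to 2^{\mathbb X}$ a constraint correspondence with nonempty values and graph $Gr(\Gamma)=\{(s,x): x\in\Gamma(s)\}$, $q_0\in\Delta(\mathbb S)$ an initial distribution, $Q:Gr(\Gamma)\to\Delta(\mathbb S)$ the true transition probability function, $\pi:Gr(\Gamma)\times\mathbb S\to\mathbb R$ a payoff function and $\delta\in[0,1)$ a discount factor. Let $\{Q_\theta:\theta\in\Theta\}$ be a nonempty family of transition probability functions $Q_\theta:Gr(\Gamma)\to\Delta(\mathbb S)$. These data form a subjective Markov decision process (SMDP). It is *regular* if - $\Theta$ is a compact subset of a Euclidean space; - $\theta\mapsto Q_\theta(s'\mid s,x)$ is continuous on $\Theta$ for all $(s',s,x)\in\mathbb S\times Gr(\Gamma)$; - there is a dense set $\hat\Theta\subseteq\Theta$ such that for all $\theta\in\hat\Theta$, $Q_\theta(s'\mid s,x)>0$ for all $(s',s,x)\in\mathbb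 S\times Gr(\Gamma)$ with $Q(s'\mid s,x)>0$. A *strategy* is a map $\sigma:\mathbb S\to\Delta(\mathbb X)$ with $\sigma(x\mid s)=0$ whenever $x\notin\Gamma(s)$. For a transition probability function $Q'$, let $V_{Q'}:\mathbb S\to\mathbb R$ be the unique solution of the Bellman equation $$V_{Q'}(s)=\max_{x\in\Gamma(s)}\sum_{s'\in\mathbb S}\{\pi(s,x,s')+\delta V_{Q'}(s')\}\,Q'(s'\mid s,x).$$ The strategy $\sigma$ is *optimal* for $Q'$ if for all $s$ and all $x$ with $\sigma(x\mid s)>0$, the action $x$ attains this maximum. A distribution $m\in\Delta(Gr(\Gamma))$ is *stationary* given $(\sigma,Q)$ if $$m(s',x')=\sum_{(s,x)\in Gr(\Gamma)}\sigma(x'\mid s')\,Q(s'\mid s,x)\,m(s,x)\qquad\text{for all }(s',x')\in Gr(\Gamma).$$ The *weighted Kullback–Leibler divergence* of $m\in\Delta(Gr(\Gamma))$ and $\theta\in\Theta$ is $$K_Q(m,\theta)=\sum_{(s,x)\in Gr(\Gamma)}\Big(\sum_{s'\in\mathbb S}Q(s'\mid s,x)\ln\frac{Q(s'\mid s,x)}{Q_\theta(s'\mid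 s,x)}\Big)m(s,x)\in[0,\infty],$$ where terms with $Q(s'\mid s,x)=0$ are $0$, $\ln(q/0)=\infty$ for $q>0$, and $\infty\cdot 0=0$; and $\Theta_Q(m)=\arg\min_{\theta\in\Theta}K_Q(m,\theta)$. A pair $(\sigma,m)$ of a strategy and a distribution $m\in\Delta(Gr(\Gamma))$ is a *Berk–Nash equilibrium* if there is a belief $\mu\in\Delta(\Theta)$ such that (i) $\sigma$ is optimal for the averaged transition probability function $\bar Q_\mu=\int_\Theta Q_\theta\,\mu(d\theta)$; (ii) $\mu$ is concentrated on $\Theta_Q(m)$; and (iii) $m$ is stationary given $(\sigma,Q)$. **Theorem.** Every regular SMDP has a Berk–Nash equilibrium. -/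

import Mathlib

noncomputable section

/-- The graph of a constraint correspondence: the pairs (state, feasible action). -/
def Gr {S X : Type*} (Γ : S → Set X) : Set (S × X) := {p | p.2 ∈ Γ p.1}

instance Gr.fintype {S X : Type*} [Fintype S] [Fintype X] (Γ : S → Set X) :
    Fintype (Gr Γ) := Fintype.ofFinite _

/-- A Markov decision process with finite state space `S` and finite action space `X`.
The set `Δ(A)` of probability distributions on a finite set `A` is `stdSimplex ℝ A`. -/
structure MDP (S X : Type*) [Fintype S] [Fintype X] where
  /-- the constraint correspondence -/
  Γ : S → Set X
  Γ_nonempty : ∀ s, (Γ s).Nonempty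
  /-- the distribution of the initial state -/
  q₀ : stdSimplex ℝ S
  /-- the transition probability function; `Q z s'` is `Q(s' | s, x)` for `z = (s, x)` -/
  Q : Gr Γ → stdSimplex ℝ S
  /-- the per-period payoff -/
  payoff : Gr Γ → S → ℝ
  /-- the discount factor -/
  δ : ℝ
  δ_nonneg : 0 ≤ δ
  δ_lt_one : δ < 1

namespace MDP

variable {S X : Type*} [Fintype S] [Fintype X]

/-- The expected payoff `∫ (π(s, x, s') + δ V(s')) Q(ds' | s, x)` of the feasible pair
`z = (s, x)` when continuation values are given by `V`. -/
def actionValue (M : MDP S X) (V : S → ℝ) (z : Gr M.Γ) : ℝ :=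
  ∑ s', (M.payoff z s' + M.δ * V s') * M.Q z s'

/-- `V` solves the Bellman equation: `V s` is the maximum over `x ∈ Γ s` of the expected
payoff of `x` at `s`. -/
def IsBellmanSolution (M : MDP S X) (V : S → ℝ) : Prop :=
  ∀ s, IsGreatest {v : ℝ | ∃ (x : X) (hx : x ∈ M.Γ s), v = M.actionValue V ⟨(s, x), hx⟩} (V s)

theorem exists_isGreatest (M : MDP S X) (V : S → ℝ) (s : S) :
    ∃ a, IsGreatest {v : ℝ | ∃ (x : X) (hx : x ∈ M.Γ s), v = M.actionValue V ⟨(s, x), hx⟩} a := by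
  obtain ⟨x₀, hx₀⟩ := M.Γ_nonempty s
  have hfin : {v : ℝ | ∃ (x : X) (hx : x ∈ M.Γ s),
      v = M.actionValue V ⟨(s, x), hx⟩}.Finite := by
    refine (Set.finite_range (fun z : Gr M.Γ => M.actionValue V z)).subset ?_
    rintro v ⟨x, hx, rfl⟩
    exact ⟨_, rfl⟩
  exact ⟨_, Set.Nonempty.csSup_mem ⟨_, x₀, hx₀, rfl⟩ hfin,
    fun a ha => le_csSup hfin.bddAbove ha⟩

theorem actionValue_le_add (M : MDP S X) (V W : S → ℝ) (z : Gr M.Γ) :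
    M.actionValue V z ≤ M.actionValue W z + M.δ * dist V W := by
  have hone : ∑ s', M.Q z s' = 1 := (M.Q z).2.2
  have h : M.actionValue W z + M.δ * dist V W
      = ∑ s', (M.payoff z s' + M.δ * (W s' + dist V W)) * M.Q z s' := by
    rw [← mul_one (M.δ * dist V W), ← hone, Finset.mul_sum, actionValue,
      ← Finset.sum_add_distrib]
    exact Finset.sum_congr rfl fun s' _ => by ring
  rw [h]
  refine Finset.sum_le_sum fun s' _ => mul_le_mul_of_nonneg_right ?_ ((M.Q z).2.1 s')
  have h1 : V s' - W s' ≤ dist V W :=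
    (le_abs_self _).trans ((Real.dist_eq (V s') (W s')).symm.le.trans (dist_le_pi_dist V W s'))
  have h2 := mul_le_mul_of_nonneg_left (show V s' ≤ W s' + dist V W by linarith) M.δ_nonneg
  linarith

/-- The Bellman equation has exactly one solution. -/
theorem existsUnique_isBellmanSolution (M : MDP S X) : ∃! V, M.IsBellmanSolution V := by
  choose T hT using M.exists_isGreatest
  have hle : ∀ V W s, T V s ≤ T W s + M.δ * dist V W := by
    intro V W s
    obtain ⟨x, hx, hv⟩ := (hT V s).1
    rw [hv]
    exact (M.actionValue_le_add V W _).trans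
      (add_le_add_left ((hT W s).2 ⟨x, hx, rfl⟩) _)
  have hc : ContractingWith ⟨M.δ, M.δ_nonneg⟩ T := by
    refine ⟨M.δ_lt_one, LipschitzWith.of_dist_le_mul fun V W => ?_⟩
    refine (dist_pi_le_iff (mul_nonneg M.δ_nonneg dist_nonneg)).2 fun s => ?_
    rw [Real.dist_eq, abs_le]
    have h1 := hle V W s
    have h2 := hle W V s
    rw [dist_comm W V] at h2
    constructor
    · change -(M.δ * dist V W) ≤ _
      linarith
    · change _ ≤ M.δ * dist V W
      linarith
  refine ⟨hc.fixedPoint, fun s => ?_, fun V hV => ?_⟩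
  · have h := hT hc.fixedPoint s
    rwa [hc.fixedPoint_isFixedPt] at h
  · exact hc.fixedPoint_unique (funext fun s => (hT V s).unique (hV s))

/-- The value function: the unique solution of the Bellman equation. -/
def value (M : MDP S X) : S → ℝ := M.existsUnique_isBellmanSolution.choose

/-- A strategy assigns to every state a distribution over the actions feasible there. -/
def Strategy (M : MDP S X) : Type _ :=
  {σ : S → stdSimplex ℝ X // ∀ s x, x ∉ M.Γ s → σ s x = 0}

/-- `σ` is optimal: every action played with positive probability at `s` maximizes the
expected payoff, with continuation values `M.value`, over the actions feasible at `s`. -/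
def IsOptimal (M : MDP S X) (σ : M.Strategy) : Prop :=
  ∀ s x, 0 < σ.1 s x → ∃ hx : x ∈ M.Γ s, ∀ (y : X) (hy : y ∈ M.Γ s),
    M.actionValue M.value ⟨(s, y), hy⟩ ≤ M.actionValue M.value ⟨(s, x), hx⟩

/-- The transition kernel `M_{σ,Q}(z' | z) = σ(x' | s') Q(s' | s, x)` on the graph of `Γ`, for
`z = (s, x)` and `z' = (s', x')`. -/
def kernel (M : MDP S X) (σ : M.Strategy) (z z' : Gr M.Γ) : ℝ :=
  σ.1 z'.1.1 z'.1.2 * M.Q z z'.1.1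

/-- `m` is a stationary distribution given `σ` and the transition function of `M`. -/
def IsStationary (M : MDP S X) (σ : M.Strategy) (m : stdSimplex ℝ (Gr M.Γ)) : Prop :=
  ∀ z', m z' = ∑ z, M.kernel σ z z' * m z

/-- The MDP with the same primitives except for the transition function. -/
def withTransition (M : MDP S X) (Q' : Gr M.Γ → stdSimplex ℝ S) : MDP S X :=
  { M with Q := Q' }

end MDP

/-- A subjective Markov decision process: an MDP with a nonempty family of transition
functions `Qsub θ`, indexed by the parameters `θ` in a subset `Θ` of `E`. Measurability in the
parameter makes the averaged transition functions meaningful. -/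
structure SMDP (S X E : Type*) [Fintype S] [Fintype X] [MeasurableSpace E] extends
    MDP S X where
  /-- the set of parameters -/
  Θ : Set E
  Θ_nonempty : Θ.Nonempty
  /-- the subjective transition functions -/
  Qsub : Θ → Gr Γ → stdSimplex ℝ S
  measurable_Qsub : ∀ z s', Measurable fun θ => Qsub θ z s'

namespace SMDP

open MeasureTheory

variable {S X E : Type*} [Fintype S] [Fintype X] [MeasurableSpace E]

/-- Regularity of an SMDP with parameters in a Euclidean space. -/
structure IsRegular {k : ℕ} (P : SMDP S X (EuclideanSpace ℝ (Fin k))) : Prop where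
  isCompact : IsCompact P.Θ
  continuous : ∀ z s', Continuous fun θ => P.Qsub θ z s'
  dense : ∃ D : Set P.Θ, Dense D ∧ ∀ θ ∈ D, ∀ z s', 0 < P.Q z s' → 0 < P.Qsub θ z s'

/-- The weighted Kullback-Leibler divergence
`K(m, θ) = ∑_{(s,x)} E_{Q(· | s,x)} [ln (Q(S' | s,x) / Q_θ(S' | s,x))] m(s,x)`,
with `ln (q / 0) = ∞` for `q > 0` and `0 · ln (0 / q) = 0`, `0 · ∞ = 0`. -/
def wKLD (P : SMDP S X E) (m : stdSimplex ℝ (Gr P.Γ)) (θ : P.Θ) : EReal :=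
  ∑ z, (∑ s', ((P.Q z s' : ℝ) : EReal) *
    ENNReal.log (ENNReal.ofReal (P.Q z s') / ENNReal.ofReal (P.Qsub θ z s'))) * ((m z : ℝ) : EReal)

/-- The closest parameter values given `m`: the minimizers of `K(m, ·)` over `Θ`. -/
def closest (P : SMDP S X E) (m : stdSimplex ℝ (Gr P.Γ)) : Set P.Θ :=
  {θ | ∀ θ', P.wKLD m θ ≤ P.wKLD m θ'}

theorem integrable_Qsub (P : SMDP S X E) (μ : ProbabilityMeasure P.Θ) (z : Gr P.Γ) (s' : S) :
    Integrable (fun θ => P.Qsub θ z s') (μ : Measure P.Θ) := by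
  refine Integrable.of_bound (P.measurable_Qsub z s').aestronglyMeasurable 1
    (Filter.Eventually.of_forall fun θ => ?_)
  have h0 : 0 ≤ P.Qsub θ z s' := (P.Qsub θ z).2.1 s'
  rw [Real.norm_eq_abs, abs_of_nonneg h0]
  exact (mem_Icc_of_mem_stdSimplex (P.Qsub θ z).2 s').2

/-- The averaged transition function `∫ Q_θ μ(dθ)` for the belief `μ`. -/
def meanTransition (P : SMDP S X E) (μ : ProbabilityMeasure P.Θ) (z : Gr P.Γ) :
    stdSimplex ℝ S :=
  ⟨fun s' => ∫ θ, P.Qsub θ z s' ∂(μ : Measure P.Θ),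
    fun s' => integral_nonneg fun θ => (P.Qsub θ z).2.1 s', by
      rw [← integral_finsetSum _ fun s' _ => P.integrable_Qsub μ z s']
      have h : ∀ θ, ∑ s', P.Qsub θ z s' = 1 := fun θ => (P.Qsub θ z).2.2
      simp [h]⟩

/-- `(σ, m)` is a Berk-Nash equilibrium: for some belief `μ` on `Θ`, the strategy `σ` is optimal
for the MDP with the averaged transition function, `μ` is concentrated on the closest parameter
values given `m`, and `m` is stationary given `σ` and the true transition function. -/
def IsBerkNash (P : SMDP S X E) (σ : P.toMDP.Strategy) (m : stdSimplex ℝ (Gr P.Γ)) : Prop :=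
  ∃ μ : ProbabilityMeasure P.Θ,
    (P.toMDP.withTransition (P.meanTransition μ)).IsOptimal σ ∧
    (∀ᵐ θ ∂(μ : Measure P.Θ), θ ∈ P.closest m) ∧
    P.toMDP.IsStationary σ m

end SMDP

end

/-! An equilibrium is a fixed point of a correspondence on triples `(σ, m, q)`: `q` is sent to the
strategies optimal for it, `(σ, m)` to the distribution of the next state and action, and `m` to the
transition functions of its closest parameters. Carrying the mean transition `q` instead of the
belief keeps the problem finite-dimensional. The belief is recovered at the end: a point of the
convex hull of the `Qsub θ` with `θ` closest is the barycenter of a measure on closest parameters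
(`exists_probabilityMeasure_of_mem_convexHull`).

Transition functions of closest parameters need not form a convex set, so Kakutani's theorem is used
in the form `exists_mem_closure_convexHull_of_isCompact`: a compact graph yields a point in the
closed convex hull of its own value. Passing to closed hulls keeps all equilibrium conditions:
optimality is linear in the strategy, the next distribution is a single point, and the hull of a
compact set is already closed in finite dimension.

Compactness of the graph rests on two facts. The value function is continuous in the transition
function (`dist_value_le`), hence optimality is a closed condition. The divergence can be infinite,
but the closest parameters still have a closed graph (`isClosed_closest`), by comparing continuous
truncations of the divergence with its finite values on the dense set given by regularity.

Kakutani's theorem follows from Brouwer's for C¹ maps through smooth averages of a selection, and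
Brouwer's from the absence of a C¹ retraction onto the sphere, shown by a volume that is polynomial
in a homotopy parameter. -/

section Brouwer

open Metric MeasureTheory Filter Topology

/-! ### Brouwer's fixed point theorem for C¹ maps -/

/-- The determinant of `1 + A` is a fixed affine combination of the determinants of
`1 + v i • A`, for any `finrank + 1` distinct nodes `v i`. -/
theorem exists_det_one_add_eq_sum {n : ℕ} {v : Fin (n + 1) → ℝ} (hv : Function.Injective v) :
    ∃ c : Fin (n + 1) → ℝ, ∑ i, c i = 1 ∧
      ∀ A : EuclideanSpace ℝ (Fin n) →L[ℝ] EuclideanSpace ℝ (Fin n),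
        (1 + A).det = ∑ i, c i * (1 + v i • A).det := by
  have key : ∀ A : EuclideanSpace ℝ (Fin n) →L[ℝ] EuclideanSpace ℝ (Fin n),
      (1 + A).det = ∑ i, (Lagrange.basis Finset.univ v i).eval 1 * (1 + v i • A).det := by
    intro A
    let b := (EuclideanSpace.basisFun (Fin n) ℝ).toBasis
    let M := LinearMap.toMatrix b b (A : EuclideanSpace ℝ (Fin n) →ₗ[ℝ] EuclideanSpace ℝ (Fin n))
    -- `det (1 + t • A)` is a polynomial in `t` of degree at most `n`, so Lagrange interpolation at
    -- `n + 1` nodes recovers its value at `1`, with weights independent of `A`.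
    let p : Polynomial ℝ := Matrix.det ((Polynomial.X : Polynomial ℝ) • M.map Polynomial.C
      + (1 : Matrix (Fin n) (Fin n) ℝ).map Polynomial.C)
    have hp : ∀ t : ℝ, p.eval t = (1 + t • A).det := by
      intro t
      have h1 : (1 + t • A).det = Matrix.det (1 + t • M) := by
        rw [ContinuousLinearMap.det, ← LinearMap.det_toMatrix b]
        congr 1
        simp only [M, ContinuousLinearMap.toLinearMap_add,
          ContinuousLinearMap.toLinearMap_smul, map_add, map_smul]
        congr 1
        exact LinearMap.toMatrix_one b
      rw [h1, ← Polynomial.coe_evalRingHom, RingHom.map_det]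
      congr 1
      ext i j
      simp only [RingHom.mapMatrix_apply, Matrix.map_apply, Matrix.add_apply, Matrix.smul_apply,
        Polynomial.coe_evalRingHom, smul_eq_mul, Polynomial.eval_add, Polynomial.eval_mul,
        Polynomial.eval_X, Polynomial.eval_C]
      ring
    have hdeg : p.degree < (Finset.univ : Finset (Fin (n + 1))).card := by
      have := Polynomial.natDegree_det_X_add_C_le M (1 : Matrix (Fin n) (Fin n) ℝ)
      refine lt_of_le_of_lt Polynomial.degree_le_natDegree ?_
      simp only [Fintype.card_fin, Finset.card_univ] at this ⊢
      exact_mod_cast Nat.lt_succ_of_le this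
    have h := Lagrange.eq_interpolate (s := Finset.univ) (v := v) hv.injOn hdeg
    have h1 := congrArg (Polynomial.eval 1) h
    rw [hp, one_smul, Lagrange.interpolate_apply, Polynomial.eval_finsetSum] at h1
    rw [h1]
    refine Finset.sum_congr rfl fun i _ => ?_
    rw [Polynomial.eval_mul, Polynomial.eval_C, hp, mul_comm]
  refine ⟨_, ?_, key⟩
  -- At `A = 0` all determinants are `1`, so the weights sum to `1`.
  have := key 0
  simpa [ContinuousLinearMap.det] using this.symm

/-- A map on a ball which is Lipschitz and vanishes on the sphere, extended by zero, is Lipschitz. -/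
theorem norm_indicator_sub_le {E : Type*} [NormedAddCommGroup E] [NormedSpace ℝ E] {R L : ℝ}
    (hL : 0 ≤ L) {g : E → E}
    (hg : ∀ x ∈ closedBall (0 : E) R, ∀ y ∈ closedBall (0 : E) R, ‖g x - g y‖ ≤ L * ‖x - y‖)
    (h0 : ∀ x, ‖x‖ = R → g x = 0) (x y : E) :
    ‖(closedBall (0 : E) R).indicator g x - (closedBall (0 : E) R).indicator g y‖
      ≤ L * ‖x - y‖ := by
  have mixed : ∀ x ∈ closedBall (0 : E) R, ∀ y ∉ closedBall (0 : E) R, ‖g x‖ ≤ L * ‖x - y‖ := by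
    intro x hx y hy
    rw [mem_closedBall_zero_iff] at hx hy
    push Not at hy
    -- The segment from `x` to `y` meets the sphere, where `g` vanishes, at a point no farther from
    -- `x` than `y` is.
    have hc : ContinuousOn (fun t : ℝ => ‖x + t • (y - x)‖) (Set.Icc 0 1) := by fun_prop
    obtain ⟨t, ht, htR⟩ := intermediate_value_Icc zero_le_one hc
      (show R ∈ Set.Icc _ _ by simpa using ⟨hx, hy.le⟩)
    simp only at htR
    have := hg x (by simpa using hx) (x + t • (y - x)) (by simpa using htR.le)
    rw [h0 _ htR, sub_zero] at this
    refine this.trans (mul_le_mul_of_nonneg_left ?_ hL)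
    rw [sub_add_cancel_left, norm_neg, norm_smul, norm_sub_rev y x, Real.norm_eq_abs,
      abs_of_nonneg ht.1]
    exact mul_le_of_le_one_left (norm_nonneg _) ht.2
  by_cases hx : x ∈ closedBall (0 : E) R <;> by_cases hy : y ∈ closedBall (0 : E) R
  · simpa [hx, hy] using hg x hx y hy
  · simpa [hx, hy] using mixed x hx y hy
  · simpa [hx, hy, norm_sub_rev x y] using mixed y hy x hx
  · simpa [hx, hy] using mul_nonneg hL (norm_nonneg _)

/-- A perturbation of the identity by a small Lipschitz map is surjective. -/
theorem surjective_add_of_lipschitz {E : Type*} [NormedAddCommGroup E] [CompleteSpace E]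
    {L : ℝ} (hL0 : 0 ≤ L) (hL : L < 1) {g : E → E} (hg : ∀ x y, ‖g x - g y‖ ≤ L * ‖x - y‖) :
    Function.Surjective fun x => x + g x := by
  intro y
  have hc : ContractingWith ⟨L, hL0⟩ (fun x => y - g x) := by
    refine ⟨hL, LipschitzWith.of_dist_le_mul fun a b => ?_⟩
    rw [dist_eq_norm, dist_eq_norm, sub_sub_sub_cancel_left, norm_sub_rev a b]
    exact hg b a
  refine ⟨hc.fixedPoint, ?_⟩
  have h := hc.fixedPoint_isFixedPt
  have h' : y - g hc.fixedPoint = hc.fixedPoint := h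
  exact (eq_add_of_sub_eq h').symm

/-- There is no continuously differentiable retraction of a closed ball onto its sphere. -/
theorem not_exists_contDiff_retraction {n : ℕ} {R : ℝ} (hR : 0 < R)
    {r : EuclideanSpace ℝ (Fin n) → EuclideanSpace ℝ (Fin n)}
    (hr : ∀ x ∈ closedBall (0 : EuclideanSpace ℝ (Fin n)) R, ContDiffAt ℝ 1 r x)
    (hmap : ∀ x ∈ closedBall (0 : EuclideanSpace ℝ (Fin n)) R, ‖r x‖ = R)
    (hfix : ∀ x, ‖x‖ = R → r x = x) : False := by
  let E := EuclideanSpace ℝ (Fin n)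
  -- `1 + t • A x` is the derivative of the homotopy `x + t • (r x - x)` from the identity to `r`.
  -- The integral of its determinant is the volume of the ball for small `t`, hence by interpolation
  -- also at `t = 1`, where the determinant vanishes.
  let A : E → E →L[ℝ] E := fun x => fderiv ℝ r x - 1
  have hrd : ∀ x ∈ closedBall (0 : E) R, HasFDerivAt r (fderiv ℝ r x) x := fun x hx =>
    ((hr x hx).differentiableAt one_ne_zero).hasFDerivAt
  have hAd : ∀ x ∈ closedBall (0 : E) R, HasFDerivAt (fun x => r x - x) (A x) x := fun x hx =>
    (hrd x hx).sub (hasFDerivAt_id x)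
  have hAc : ContinuousOn A (closedBall (0 : E) R) := fun x hx =>
    (((hr x hx).fderiv_right (m := 0) (by simp)).continuousAt.sub
      continuousAt_const).continuousWithinAt
  obtain ⟨L, hL⟩ := (isCompact_closedBall (0 : E) R).exists_bound_of_continuousOn hAc
  have hL0 : 0 ≤ L := (norm_nonneg _).trans (hL 0 (by simp [hR.le]))
  let g : E → E := (closedBall (0 : E) R).indicator fun x => r x - x
  have hg : ∀ x y, ‖g x - g y‖ ≤ L * ‖x - y‖ := by
    refine norm_indicator_sub_le hL0 (fun x hx y hy => ?_) (fun x hx => by simp [hfix x hx])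
    exact (convex_closedBall (0 : E) R).norm_image_sub_le_of_norm_fderiv_le
      (fun z hz => (hAd z hz).differentiableAt)
      (fun z hz => by rw [(hAd z hz).fderiv]; exact hL z hz) hy hx
  -- the change of variables for small parameters
  have hsmall : ∀ t : ℝ, 0 < t → t < 1 → t * L < 1 →
      ∫ x in ball (0 : E) R, |(1 + t • A x).det| = volume.real (ball (0 : E) R) := by
    intro t ht0 ht1 htL
    have htg : ∀ x y, ‖t • g x - t • g y‖ ≤ t * L * ‖x - y‖ := fun x y => by
      rw [← smul_sub, norm_smul, Real.norm_eq_abs, abs_of_pos ht0, mul_assoc]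
      exact mul_le_mul_of_nonneg_left (hg x y) ht0.le
    let f : E → E := fun x => x + t • g x
    have hfball : ∀ x ∈ ball (0 : E) R, f x = x + t • (r x - x) := fun x hx => by
      simp only [f, g, Set.indicator_of_mem (ball_subset_closedBall hx)]
    have hinj : Set.InjOn f (ball (0 : E) R) := by
      intro x _ y _ hxy
      have h1 : x - y = -(t • g x - t • g y) := by
        have : x + t • g x = y + t • g y := hxy
        rw [neg_sub, sub_eq_sub_iff_add_eq_add, this, add_comm]
      have h2 := htg x y
      rw [← norm_neg, ← h1] at h2
      by_contra hne
      have : 0 < ‖x - y‖ := norm_pos_iff.2 (sub_ne_zero.2 hne)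
      nlinarith
    -- A proper convex combination of a point of the open ball and a point of the sphere stays in
    -- the open ball. Conversely `f` is onto the whole space and fixes every point outside the open
    -- ball, so preimages of ball points lie in the ball.
    have himg : f '' ball (0 : E) R = ball (0 : E) R := by
      apply Set.Subset.antisymm
      · rintro _ ⟨x, hx, rfl⟩
        rw [hfball x hx, mem_ball_zero_iff]
        have h1 : x + t • (r x - x) = (1 - t) • x + t • r x := by module
        rw [h1]
        refine (norm_add_le _ _).trans_lt ?_
        rw [norm_smul, norm_smul, hmap x (ball_subset_closedBall hx), Real.norm_eq_abs,
          Real.norm_eq_abs, abs_of_pos ht0, abs_of_pos (sub_pos.2 ht1)]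
        rw [mem_ball_zero_iff] at hx
        nlinarith [sub_pos.2 ht1]
      · intro y hy
        obtain ⟨x, hx⟩ := surjective_add_of_lipschitz (mul_nonneg ht0.le hL0) htL htg y
        refine ⟨x, ?_, hx⟩
        by_contra hxb
        have hg0 : g x = 0 := by
          by_cases hxc : x ∈ closedBall (0 : E) R
          · have hxR : ‖x‖ = R := by
              rw [mem_closedBall_zero_iff] at hxc
              rw [mem_ball_zero_iff, not_lt] at hxb
              exact le_antisymm hxc hxb
            simp [g, hxc, hfix x hxR]
          · simp [g, hxc]
        simp only [hg0, smul_zero, add_zero] at hx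
        exact hxb (hx ▸ hy)
    have hder : ∀ x ∈ ball (0 : E) R,
        HasFDerivWithinAt f (1 + t • A x) (ball (0 : E) R) x := fun x hx => by
      have h1 : HasFDerivAt (fun x => x + t • (r x - x)) (1 + t • A x) x :=
        (hasFDerivAt_id x).add ((hAd x (ball_subset_closedBall hx)).const_smul t)
      exact h1.hasFDerivWithinAt.congr hfball (hfball x hx)
    have h := integral_image_eq_integral_abs_det_fderiv_smul volume measurableSet_ball hder hinj
      (fun _ => (1 : ℝ))
    rw [himg] at h
    simpa using h.symm
  -- positivity of the determinants for small parameters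
  have hpos : ∃ τ : ℝ, 0 < τ ∧ ∀ t : ℝ, 0 < t → t < τ →
      ∀ x ∈ closedBall (0 : E) R, 0 < (1 + t • A x).det := by
    have hev : ∀ᶠ B : E →L[ℝ] E in 𝓝 0, 0 < (1 + B).det := by
      have hc : Continuous fun B : E →L[ℝ] E => (1 + B).det :=
        ContinuousLinearMap.continuous_det.comp (continuous_const.add continuous_id)
      refine hc.continuousAt.eventually (lt_mem_nhds ?_)
      simp [ContinuousLinearMap.det]
    obtain ⟨ε, hε, hball⟩ := Metric.eventually_nhds_iff.1 hev
    refine ⟨ε / (L + 1), by positivity, fun t ht0 ht x hx => hball ?_⟩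
    rw [dist_zero_right, norm_smul, Real.norm_eq_abs, abs_of_pos ht0]
    rw [lt_div_iff₀ (by positivity)] at ht
    nlinarith [hL x hx]
  obtain ⟨τ, hτ, hpos⟩ := hpos
  set τ' : ℝ := min τ (min 1 (1 / (L + 1)))
  have hτ' : 0 < τ' := by positivity
  -- The shift by `2` makes every node strictly smaller than `τ'`; the bound `1 / (L + 1)` in `τ'`
  -- gives `v i * L < 1` even when `L = 0`.
  let v : Fin (n + 1) → ℝ := fun i => τ' / ((i : ℝ) + 2)
  have hv0 : ∀ i, 0 < v i := fun i => by positivity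
  have hvτ : ∀ i, v i < τ' := fun i => by
    have : (0 : ℝ) ≤ (i : ℕ) := Nat.cast_nonneg _
    exact div_lt_self hτ' (by linarith)
  have hvinj : Function.Injective v := by
    intro i j hij
    have h2 : ∀ k : Fin (n + 1), ((k : ℕ) : ℝ) + 2 ≠ 0 := fun k => by positivity
    have h3 : τ' / (((i : ℕ) : ℝ) + 2) = τ' / (((j : ℕ) : ℝ) + 2) := hij
    rw [div_eq_div_iff (h2 i) (h2 j)] at h3
    have h4 := mul_left_cancel₀ hτ'.ne' h3
    have h5 : ((i : ℕ) : ℝ) = (j : ℕ) := by linarith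
    exact Fin.ext (by exact_mod_cast h5)
  have hvol : ∀ i, ∫ x in ball (0 : E) R, (1 + v i • A x).det = volume.real (ball (0 : E) R) := by
    intro i
    have h1 : v i < 1 := (hvτ i).trans_le ((min_le_right _ _).trans (min_le_left _ _))
    have h2 : v i < 1 / (L + 1) := (hvτ i).trans_le ((min_le_right _ _).trans (min_le_right _ _))
    rw [lt_div_iff₀ (by positivity)] at h2
    rw [← hsmall (v i) (hv0 i) h1 (by nlinarith [hv0 i])]
    refine setIntegral_congr_fun measurableSet_ball fun x hx => ?_
    exact (abs_of_pos (hpos _ (hv0 i) ((hvτ i).trans_le (min_le_left _ _)) x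
      (ball_subset_closedBall hx))).symm
  have hint : ∀ i, IntegrableOn (fun x => (1 + v i • A x).det) (ball (0 : E) R) := fun i => by
    refine IntegrableOn.mono_set (ContinuousOn.integrableOn_compact (isCompact_closedBall 0 R) ?_)
      ball_subset_closedBall
    exact ContinuousLinearMap.continuous_det.comp_continuousOn
      (continuousOn_const.add (hAc.const_smul (v i)))
  obtain ⟨c, hc1, hc⟩ := exists_det_one_add_eq_sum hvinj
  have hfull : ∫ x in ball (0 : E) R, (1 + A x).det = volume.real (ball (0 : E) R) := by
    rw [setIntegral_congr_fun measurableSet_ball fun x _ => hc (A x),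
      integral_finsetSum _ fun i _ => (hint i).const_mul (c i)]
    simp_rw [integral_const_mul, hvol, ← Finset.sum_mul, hc1, one_mul]
  -- Since `‖r‖` is constant, `r x` is orthogonal to the range of the derivative of `r`. An
  -- invertible derivative would have `r x` in its range and force `r x = 0`.
  have hzero : ∀ x ∈ ball (0 : E) R, (1 + A x).det = 0 := by
    intro x hx
    have hxc := ball_subset_closedBall hx
    have hA : 1 + A x = fderiv ℝ r x := by simp [A]
    rw [hA]
    by_contra hdet
    have hsurj : Function.Surjective (fderiv ℝ r x) :=
      (LinearMap.equivOfDetNeZero (fderiv ℝ r x : E →ₗ[ℝ] E) hdet).surjective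
    obtain ⟨w, hw⟩ := hsurj (r x)
    have h1 := (hrd x hxc).inner ℝ (hrd x hxc)
    have h2 : HasFDerivAt (fun y => inner ℝ (r y) (r y)) (0 : E →L[ℝ] ℝ) x := by
      refine (hasFDerivAt_const (R ^ 2) x).congr_of_eventuallyEq ?_
      filter_upwards [isOpen_ball.mem_nhds hx] with y hy
      rw [real_inner_self_eq_norm_sq, hmap y (ball_subset_closedBall hy)]
    have h3 := congrArg (fun T : E →L[ℝ] ℝ => T w) (h1.unique h2)
    simp [fderivInnerCLM_apply, hw] at h3
    have h4 := hmap x hxc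
    rw [h3, norm_zero] at h4
    exact hR.ne h4
  rw [setIntegral_congr_fun measurableSet_ball (g := fun _ => (0 : ℝ)) hzero] at hfull
  have hv : 0 < volume.real (ball (0 : E) R) :=
    ENNReal.toReal_pos (measure_ball_pos volume _ hR).ne' measure_ball_lt_top.ne
  simp at hfull
  linarith

/-- Brouwer's fixed point theorem for continuously differentiable maps of a ball. -/
theorem exists_fixedPoint_of_contDiffAt_closedBall {n : ℕ} {R : ℝ} (hR : 0 < R)
    {f : EuclideanSpace ℝ (Fin n) → EuclideanSpace ℝ (Fin n)}
    (hf : ∀ x ∈ closedBall (0 : EuclideanSpace ℝ (Fin n)) R, ContDiffAt ℝ 1 f x)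
    (hmap : ∀ x ∈ closedBall (0 : EuclideanSpace ℝ (Fin n)) R, ‖f x‖ ≤ R) :
    ∃ x ∈ closedBall (0 : EuclideanSpace ℝ (Fin n)) R, f x = x := by
  by_contra! hne
  let E := EuclideanSpace ℝ (Fin n)
  let u : E → E := fun x => x - f x
  let a : E → ℝ := fun x => inner ℝ (u x) (u x)
  let b : E → ℝ := fun x => inner ℝ x (u x)
  let c : E → ℝ := fun x => R ^ 2 - inner ℝ x x
  let d : E → ℝ := fun x => b x ^ 2 + a x * c x
  -- The larger root of `a l² + 2 b l - c = 0`, that is, of `‖x + l u‖² = R²`: the ray from `f x`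
  -- through `x` is followed to the sphere.
  let l : E → ℝ := fun x => (-b x + √(d x)) / a x
  have ha : ∀ x ∈ closedBall (0 : E) R, 0 < a x := fun x hx =>
    real_inner_self_pos.2 (sub_ne_zero.2 (hne x hx).symm)
  -- On the sphere `2 b = a + R² - ‖f x‖² ≥ a > 0`. This keeps the discriminant `d` positive where
  -- `c` vanishes, so its root is smooth there, and it gives `l = 0` on the sphere.
  have hb : ∀ x, ‖x‖ = R → 0 < b x := by
    intro x hx
    have hxc : x ∈ closedBall (0 : E) R := by simp [hx]
    have h1 : a x = ‖x‖ ^ 2 - 2 * inner ℝ x (f x) + ‖f x‖ ^ 2 := by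
      simp only [a, u]
      rw [real_inner_self_eq_norm_sq, norm_sub_sq_real]
    have h2 : b x = ‖x‖ ^ 2 - inner ℝ x (f x) := by
      simp only [b, u]
      rw [inner_sub_right, real_inner_self_eq_norm_sq]
    have h3 := ha x hxc
    have h4 : ‖f x‖ ^ 2 ≤ R ^ 2 := pow_le_pow_left₀ (norm_nonneg _) (hmap x hxc) 2
    rw [h1] at h3
    rw [h2]
    rw [hx] at h3 ⊢
    linarith
  have hd : ∀ x ∈ closedBall (0 : E) R, 0 < d x := by
    intro x hx
    have hx' := mem_closedBall_zero_iff.1 hx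
    rcases hx'.lt_or_eq with h | h
    · have hc : 0 < c x := by
        simp only [c]
        rw [real_inner_self_eq_norm_sq]
        exact sub_pos.2 (pow_lt_pow_left₀ h (norm_nonneg _) two_ne_zero)
      exact add_pos_of_nonneg_of_pos (sq_nonneg _) (mul_pos (ha x hx) hc)
    · have hc : c x = 0 := by
        simp only [c]
        rw [real_inner_self_eq_norm_sq, h, sub_self]
      simp only [d, hc, mul_zero, add_zero]
      exact pow_pos (hb x h) 2
  refine not_exists_contDiff_retraction hR (r := fun x => x + l x • u x) (fun x hx => ?_)
    (fun x hx => ?_) (fun x hx => ?_)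
  · have hu : ContDiffAt ℝ 1 u x := contDiffAt_id.sub (hf x hx)
    have hca : ContDiffAt ℝ 1 a x := hu.inner ℝ hu
    have hcb : ContDiffAt ℝ 1 b x := contDiffAt_id.inner ℝ hu
    have hcc : ContDiffAt ℝ 1 c x := contDiffAt_const.sub (contDiffAt_id.inner ℝ contDiffAt_id)
    have hcd : ContDiffAt ℝ 1 d x := (hcb.pow 2).add (hca.mul hcc)
    exact contDiffAt_id.add
      (((hcb.neg.add (hcd.sqrt (hd x hx).ne')).div hca (ha x hx).ne').smul hu)
  · have h1 : ‖x + l x • u x‖ ^ 2 = R ^ 2 := by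
      rw [norm_add_sq_real, inner_smul_right, norm_smul, mul_pow, Real.norm_eq_abs, sq_abs,
        ← real_inner_self_eq_norm_sq (u x), ← real_inner_self_eq_norm_sq x]
      change inner ℝ x x + 2 * (l x * b x) + l x ^ 2 * a x = R ^ 2
      have hs := Real.sq_sqrt (hd x hx).le
      have hla : l x * a x = -b x + √(d x) := div_mul_cancel₀ _ (ha x hx).ne'
      have hmul : a x * (inner ℝ x x + 2 * (l x * b x) + l x ^ 2 * a x) = a x * R ^ 2 := by
        have : a x * (inner ℝ x x + 2 * (l x * b x) + l x ^ 2 * a x)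
            = a x * inner ℝ x x + 2 * (l x * a x) * b x + (l x * a x) ^ 2 := by ring
        rw [this, hla]
        have hs' : √(d x) ^ 2 = b x ^ 2 + a x * (R ^ 2 - inner ℝ x x) := hs
        linarith
      exact mul_left_cancel₀ (ha x hx).ne' hmul
    exact (pow_left_inj₀ (norm_nonneg _) hR.le two_ne_zero).1 h1
  · have hc : c x = 0 := by
      simp only [c]
      rw [real_inner_self_eq_norm_sq, hx, sub_self]
    have hl : l x = 0 := by
      simp only [l, d, hc, mul_zero, add_zero]
      rw [Real.sqrt_sq (hb x hx).le, neg_add_cancel, zero_div]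
    simp [hl]

end Brouwer

/-! ### Kakutani's fixed point theorem for compact graphs -/

section Kakutani

open Metric Filter Topology

/-- A closed convex set in a Hilbert space is a retract of the whole space. -/
theorem Convex.exists_continuous_retraction {E : Type*} [NormedAddCommGroup E]
    [InnerProductSpace ℝ E] [CompleteSpace E] {K : Set E} (hne : K.Nonempty) (hc : IsClosed K)
    (hK : Convex ℝ K) :
    ∃ P : E → E, Continuous P ∧ (∀ x, P x ∈ K) ∧ ∀ x ∈ K, P x = x := by
  choose P hPK hP using exists_norm_eq_iInf_of_complete_convex hne hc.isComplete hK
  -- The variational inequality of the nearest point. Adding its instances at `x` and `y` gives `‖P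
  -- x - P y‖² ≤ ⟪x - y, P x - P y⟫`, so `P` is 1-Lipschitz.
  have hin : ∀ x, ∀ w ∈ K, inner ℝ (x - P x) (w - P x) ≤ 0 := fun x =>
    (norm_eq_iInf_iff_real_inner_le_zero hK (hPK x)).1 (hP x)
  refine ⟨P, ?_, hPK, fun x hx => ?_⟩
  · refine LipschitzWith.continuous (K := 1) (LipschitzWith.of_dist_le_mul fun x y => ?_)
    rw [NNReal.coe_one, one_mul, dist_eq_norm, dist_eq_norm]
    have h1 := hin x (P y) (hPK y)
    have h2 := hin y (P x) (hPK x)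
    have h3 : inner ℝ (P x - P y) (P x - P y)
        = inner ℝ (x - y) (P x - P y) + inner ℝ (x - P x) (P y - P x)
          + inner ℝ (y - P y) (P x - P y) := by
      simp only [inner_sub_left, inner_sub_right]
      ring
    have h4 := real_inner_le_norm (x - y) (P x - P y)
    rw [real_inner_self_eq_norm_sq] at h3
    by_contra! hlt
    nlinarith [norm_nonneg (x - y)]
  · have h1 := hin x x hx
    rw [real_inner_self_eq_norm_sq] at h1
    have h2 : ‖x - P x‖ = 0 := by
      have := sq_nonneg ‖x - P x‖
      exact pow_eq_zero_iff two_ne_zero |>.1 (le_antisymm h1 this)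
    exact (sub_eq_zero.1 (norm_eq_zero.1 h2)).symm

/-- An approximate fixed point of an arbitrary map into a compact convex set. -/
theorem exists_mem_convexHull_image_ball {n : ℕ} {K : Set (EuclideanSpace ℝ (Fin n))}
    (hKc : IsCompact K) (hK : Convex ℝ K)
    {Y : EuclideanSpace ℝ (Fin n) → EuclideanSpace ℝ (Fin n)} (hY : ∀ x, Y x ∈ K) {ε : ℝ}
    (hε : 0 < ε) : ∃ x ∈ K, x ∈ convexHull ℝ (Y '' ball x ε) := by
  let E := EuclideanSpace ℝ (Fin n)
  obtain ⟨R, hR, hKR⟩ := hKc.isBounded.subset_closedBall_lt 0 (0 : E)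
  obtain ⟨t, -, htf, ht⟩ := (isCompact_closedBall (0 : E) R).finite_cover_balls hε
  lift t to Finset E using htf
  -- Smooth bumps, nonzero exactly on the `ε`-ball around `z`; the squared norm avoids the
  -- singularity of the norm at `z`.
  let b : E → E → ℝ := fun z x => Real.smoothTransition (ε ^ 2 - inner ℝ (x - z) (x - z))
  have hb0 : ∀ z x, 0 ≤ b z x := fun z x => Real.smoothTransition.nonneg _
  have hbpos : ∀ z x, b z x ≠ 0 ↔ z ∈ ball x ε := by
    intro z x
    rw [mem_ball, dist_comm, dist_eq_norm, Ne, Real.smoothTransition.zero_iff_nonpos, not_le,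
      sub_pos, real_inner_self_eq_norm_sq, pow_lt_pow_iff_left₀ (norm_nonneg _) hε.le two_ne_zero]
  have hsum : ∀ x ∈ closedBall (0 : E) R, 0 < ∑ z ∈ t, b z x := by
    intro x hx
    obtain ⟨z, hz, hxz⟩ := Set.mem_iUnion₂.1 (ht hx)
    refine Finset.sum_pos' (fun z _ => hb0 z x) ⟨z, hz, ?_⟩
    exact (hb0 z x).lt_of_ne' ((hbpos z x).2 (by rwa [mem_ball, dist_comm]))
  let f : E → E := fun x => t.centerMass (fun z => b z x) Y
  have hf : ∀ x ∈ closedBall (0 : E) R, f x ∈ convexHull ℝ (Y '' ball x ε) := by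
    intro x hx
    simp only [f]
    rw [← Finset.centerMass_filter_ne_zero]
    refine Finset.centerMass_mem_convexHull _ (fun z _ => hb0 z x) ?_ fun z hz =>
      ⟨z, (hbpos z x).1 (Finset.mem_filter.1 hz).2, rfl⟩
    rw [Finset.sum_filter_ne_zero]
    exact hsum x hx
  have hfK : ∀ x ∈ closedBall (0 : E) R, f x ∈ K := fun x hx =>
    convexHull_min (by rintro _ ⟨z, -, rfl⟩; exact hY z) hK (hf x hx)
  have hsmooth : ∀ x ∈ closedBall (0 : E) R, ContDiffAt ℝ 1 f x := by
    intro x hx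
    have hbs : ∀ z, ContDiffAt ℝ 1 (b z) x := fun z => by
      have h1 : ContDiff ℝ 1 fun x : E => ε ^ 2 - inner ℝ (x - z) (x - z) :=
        contDiff_const.sub ((contDiff_id.sub contDiff_const).inner ℝ
          (contDiff_id.sub contDiff_const))
      exact ((Real.smoothTransition.contDiff (n := 1)).comp h1).contDiffAt
    have h2 : ContDiffAt ℝ 1 (fun x => ∑ z ∈ t, b z x) x := ContDiffAt.sum fun z _ => hbs z
    exact (h2.inv (hsum x hx).ne').smul
      (ContDiffAt.sum fun z _ => (hbs z).smul contDiffAt_const)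
  obtain ⟨x, hx, hfx⟩ := exists_fixedPoint_of_contDiffAt_closedBall hR hsmooth
    fun x hx => mem_closedBall_zero_iff.1 (hKR (hfK x hx))
  exact ⟨x, hfx ▸ hfK x hx, by simpa only [hfx] using hf x hx⟩

/-- Kakutani's fixed point theorem in Euclidean space, for a correspondence with compact graph
whose values need not be convex. -/
theorem exists_mem_closure_convexHull_of_euclideanSpace {n : ℕ}
    {K : Set (EuclideanSpace ℝ (Fin n))}
    (hKc : IsCompact K) (hK : Convex ℝ K) (hKne : K.Nonempty)
    {G : Set (EuclideanSpace ℝ (Fin n) × EuclideanSpace ℝ (Fin n))} (hG : IsCompact G)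
    (hGK : ∀ p ∈ G, p.2 ∈ K) (hne : ∀ x ∈ K, ∃ y, (x, y) ∈ G) :
    ∃ x ∈ K, x ∈ closure (convexHull ℝ {y | (x, y) ∈ G}) := by
  let E := EuclideanSpace ℝ (Fin n)
  obtain ⟨P, hPc, hPK, hPid⟩ := hK.exists_continuous_retraction hKne hKc.isClosed
  -- An arbitrary selection, with no continuity, suffices because only its averages over a finite
  -- net are used.
  choose Y hY using fun x => hne (P x) (hPK x)
  have happrox : ∀ k : ℕ, ∃ x ∈ K, x ∈ convexHull ℝ (Y '' ball x (1 / ((k : ℝ) + 1))) := fun k =>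
    exists_mem_convexHull_image_ball hKc hK (fun x => hGK _ (hY x)) (by positivity)
  choose x hxK hx using happrox
  obtain ⟨a, haK, φ, hφ, ha⟩ := hKc.tendsto_subseq hxK
  refine ⟨a, haK, ?_⟩
  rw [closure_eq_iInter_thickening]
  refine Set.mem_iInter₂.2 fun η hη => ?_
  -- Upper semicontinuity from compactness: the points of `G` whose second coordinate is `η`-far
  -- from the fibre over `a` project onto a closed set missing `a`.
  have hsub : ∀ η : ℝ, 0 < η → ∃ δ > 0, ∀ z ∈ ball a δ, Y z ∈ thickening η {y | (a, y) ∈ G} := by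
    intro η hη
    have hC : IsCompact (G ∩ {p | p.2 ∉ thickening η {y | (a, y) ∈ G}}) :=
      hG.inter_right ((isOpen_thickening.preimage continuous_snd).isClosed_compl)
    have hC' := (hC.image continuous_fst).isClosed
    have haC : P a ∉ Prod.fst '' (G ∩ {p | p.2 ∉ thickening η {y | (a, y) ∈ G}}) := by
      rw [hPid a haK]
      rintro ⟨⟨_, y⟩, ⟨hp, hp'⟩, rfl⟩
      exact hp' (self_subset_thickening hη _ hp)
    obtain ⟨δ, hδ, h⟩ := Metric.mem_nhds_iff.1
      (hPc.continuousAt.preimage_mem_nhds (hC'.isOpen_compl.mem_nhds haC))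
    refine ⟨δ, hδ, fun z hz => ?_⟩
    by_contra hcon
    exact h hz ⟨(P z, Y z), ⟨hY z, hcon⟩, rfl⟩
  obtain ⟨δ, hδ, hball⟩ := hsub (η / 2) (half_pos hη)
  have hev : ∀ᶠ k in atTop, dist (x (φ k)) a < min (δ / 2) (η / 2) :=
    (Metric.tendsto_nhds.1 ha) _ (by positivity)
  have hev2 : ∀ᶠ k in atTop, 1 / ((φ k : ℝ) + 1) < δ / 2 :=
    (tendsto_one_div_add_atTop_nhds_zero_nat.comp hφ.tendsto_atTop).eventually
      (gt_mem_nhds (half_pos hδ))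
  obtain ⟨k, hk1, hk2⟩ := (hev.and hev2).exists
  -- The thickening of a convex set is convex, so it contains the hull of the nearby values of `Y`,
  -- hence the approximate fixed point.
  have hmem : x (φ k) ∈ thickening (η / 2) (convexHull ℝ {y | (a, y) ∈ G}) := by
    refine convexHull_min ?_ ((convex_convexHull ℝ _).thickening _) (hx (φ k))
    rintro _ ⟨z, hz, rfl⟩
    refine thickening_subset_of_subset _ (subset_convexHull ℝ _) (hball z ?_)
    have h1 : dist z (x (φ k)) < δ / 2 := (mem_ball.1 hz).trans hk2
    have h2 := hk1.trans_le (min_le_left _ _)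
    rw [mem_ball]
    linarith [dist_triangle z (x (φ k)) a]
  obtain ⟨w, hw, hxw⟩ := mem_thickening_iff.1 hmem
  refine mem_thickening_iff.2 ⟨w, hw, ?_⟩
  have h2 := hk1.trans_le (min_le_right _ _)
  rw [dist_comm] at h2
  linarith [dist_triangle a (x (φ k)) w]

/-- Kakutani's fixed point theorem in a finite-dimensional normed space, for a correspondence with
compact graph whose values need not be convex. -/
theorem exists_mem_closure_convexHull_of_isCompact {V : Type*} [NormedAddCommGroup V]
    [NormedSpace ℝ V] [FiniteDimensional ℝ V] {K : Set V}
    (hKc : IsCompact K) (hK : Convex ℝ K) (hKne : K.Nonempty)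
    {G : Set (V × V)} (hG : IsCompact G)
    (hGK : ∀ p ∈ G, p.2 ∈ K) (hne : ∀ x ∈ K, ∃ y, (x, y) ∈ G) :
    ∃ x ∈ K, x ∈ closure (convexHull ℝ {y | (x, y) ∈ G}) := by
  let e := toEuclidean (E := V)
  obtain ⟨_, ⟨x, hx, rfl⟩, h⟩ := exists_mem_closure_convexHull_of_euclideanSpace
    (K := e '' K) (G := Prod.map e e '' G) (hKc.image e.continuous)
    (hK.is_linear_image e.toLinearEquiv.toLinearMap.isLinear) (hKne.image _)
    (hG.image (e.continuous.prodMap e.continuous))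
    (by rintro _ ⟨p, hp, rfl⟩; exact ⟨_, hGK p hp, rfl⟩)
    (by
      rintro _ ⟨x, hx, rfl⟩
      obtain ⟨y, hy⟩ := hne x hx
      exact ⟨e y, (x, y), hy, rfl⟩)
  refine ⟨x, hx, ?_⟩
  have himg : {y | (e x, y) ∈ Prod.map e e '' G} = e '' {y | (x, y) ∈ G} := by
    ext y
    constructor
    · rintro ⟨⟨p, q⟩, hp, hpq⟩
      simp only [Prod.map_apply, Prod.mk.injEq, e.injective.eq_iff] at hpq
      obtain ⟨rfl, rfl⟩ := hpq
      exact ⟨q, hp, rfl⟩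
    · rintro ⟨q, hq, rfl⟩
      exact ⟨(x, q), hq, rfl⟩
  have h2 : convexHull ℝ (e '' {y | (x, y) ∈ G}) = e '' convexHull ℝ {y | (x, y) ∈ G} :=
    (e.toLinearEquiv.toLinearMap.image_convexHull _).symm
  rw [himg, h2, ← e.image_closure] at h
  obtain ⟨w, hw, hwx⟩ := h
  exact e.injective hwx ▸ hw

end Kakutani

/-! ### Convex hulls of compact sets -/

/-- The convex hull of a compact set in a finite-dimensional space is compact. -/
theorem IsCompact.isCompact_convexHull {V : Type*} [AddCommGroup V] [Module ℝ V]
    [TopologicalSpace V] [ContinuousAdd V] [ContinuousSMul ℝ V] [FiniteDimensional ℝ V]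
    {C : Set V} (hC : IsCompact C) : IsCompact (convexHull ℝ C) := by
  rcases C.eq_empty_or_nonempty with rfl | ⟨c, hc⟩
  · simp
  -- Carathéodory: `N` points always suffice. Shorter combinations are padded with weight `0` at the
  -- point `c`.
  let N := Module.finrank ℝ V + 1
  have hdom : IsCompact (stdSimplex ℝ (Fin N) ×ˢ Set.univ.pi fun _ : Fin N => C) :=
    (isCompact_stdSimplex ℝ (Fin N)).prod (isCompact_univ_pi fun _ => hC)
  have hcont : Continuous fun p : (Fin N → ℝ) × (Fin N → V) => ∑ i, p.1 i • p.2 i := by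
    fun_prop
  convert hdom.image hcont using 1
  ext x
  constructor
  · intro hx
    obtain ⟨ι, _, z, w, hz, hind, hw, hw1, hx⟩ := eq_pos_convex_span_of_mem_convexHull hx
    have hcard : Fintype.card ι ≤ Fintype.card (Fin N) := by
      rw [Fintype.card_fin]
      exact hind.card_le_finrank_succ.trans
        (Nat.succ_le_succ (Submodule.finrank_le _))
    obtain ⟨e⟩ := Function.Embedding.nonempty_of_card_le hcard
    have hw0 : ∀ j ∉ Set.range e, Function.extend e w 0 j = 0 := fun j hj => by
      rw [Function.extend_apply' _ _ _ hj, Pi.zero_apply]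
    refine ⟨(Function.extend e w 0, Function.extend e z fun _ => c),
      ⟨⟨fun j => ?_, ?_⟩, fun j _ => ?_⟩, ?_⟩
    · by_cases hj : j ∈ Set.range e
      · obtain ⟨i, rfl⟩ := hj
        simpa only [e.injective.extend_apply] using (hw i).le
      · exact (hw0 j hj).ge
    · rw [← hw1]
      exact (Fintype.sum_of_injective e e.injective _ _ hw0
        fun i => (e.injective.extend_apply _ _ _).symm).symm
    · by_cases hj : j ∈ Set.range e
      · obtain ⟨i, rfl⟩ := hj
        simpa only [e.injective.extend_apply] using hz ⟨i, rfl⟩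
      · simpa only [Function.extend_apply' _ _ _ hj] using hc
    · rw [← hx]
      refine (Fintype.sum_of_injective e e.injective _ _ (fun j hj => ?_) fun i => ?_).symm
      · simp only [hw0 j hj, zero_smul]
      · simp only [e.injective.extend_apply]
  · rintro ⟨⟨w, z⟩, ⟨hw, hz⟩, rfl⟩
    exact (convex_convexHull ℝ C).sum_mem (fun i _ => hw.1 i) hw.2
      fun i _ => subset_convexHull ℝ C (hz i (Set.mem_univ i))

/-! ### The weighted Kullback–Leibler divergence and its minimizers -/

theorem EReal.coe_finsetSum {ι : Type*} (s : Finset ι) (f : ι → ℝ) :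
    ((∑ i ∈ s, f i : ℝ) : EReal) = ∑ i ∈ s, (f i : EReal) := by
  classical
  induction s using Finset.induction_on with
  | empty => simp
  | insert i s hi ih => rw [Finset.sum_insert hi, Finset.sum_insert hi, EReal.coe_add, ih]

theorem EReal.finsetSum_ne_bot {ι : Type*} {s : Finset ι} {f : ι → EReal}
    (h : ∀ i ∈ s, f i ≠ ⊥) : ∑ i ∈ s, f i ≠ ⊥ := by
  classical
  induction s using Finset.induction_on with
  | empty => simp
  | insert i s hi ih =>
    rw [Finset.sum_insert hi, Ne, EReal.add_eq_bot_iff, not_or]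
    exact ⟨h i (Finset.mem_insert_self i s), ih fun j hj => h j (Finset.mem_insert_of_mem hj)⟩

theorem EReal.finsetSum_eq_top {ι : Type*} {s : Finset ι} {f : ι → EReal}
    (h : ∀ i ∈ s, f i ≠ ⊥) {i : ι} (hi : i ∈ s) (hf : f i = ⊤) : ∑ i ∈ s, f i = ⊤ := by
  classical
  rw [← Finset.add_sum_erase s f hi, hf]
  exact EReal.top_add_of_ne_bot
    (EReal.finsetSum_ne_bot fun j hj => h j (Finset.mem_of_mem_erase hj))

theorem stdSimplex.continuous_eval {ι : Type*} [Fintype ι] (i : ι) :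
    Continuous fun m : stdSimplex ℝ ι => m i :=
  (continuous_apply i).comp continuous_subtype_val

namespace SMDP

open MeasureTheory Filter Topology

variable {S X E : Type*} [Fintype S] [Fintype X] [MeasurableSpace E]

/-- The transition function of `θ` charges every transition that occurs under `m`. -/
def IsAdmissible (P : SMDP S X E) (m : stdSimplex ℝ (Gr P.Γ)) (θ : P.Θ) : Prop :=
  ∀ z, m z ≠ 0 → ∀ s', P.Q z s' ≠ 0 → P.Qsub θ z s' ≠ 0

/-- The weighted Kullback-Leibler divergence as a real number, for admissible parameters. -/
noncomputable def realKLD (P : SMDP S X E) (m : stdSimplex ℝ (Gr P.Γ)) (θ : P.Θ) : ℝ :=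
  ∑ z, ∑ s', P.Q z s' * (Real.log (P.Q z s') - Real.log (P.Qsub θ z s')) * m z

/-- The weighted Kullback-Leibler divergence with the subjective probabilities bounded below
by `ε`. -/
noncomputable def truncKLD (P : SMDP S X E) (ε : ℝ) (m : stdSimplex ℝ (Gr P.Γ)) (θ : P.Θ) : ℝ :=
  ∑ z, ∑ s', P.Q z s' * (Real.log (P.Q z s') - Real.log (max (P.Qsub θ z s') ε)) * m z

theorem wKLD_eq_realKLD {P : SMDP S X E} {m : stdSimplex ℝ (Gr P.Γ)} {θ : P.Θ}
    (h : P.IsAdmissible m θ) : P.wKLD m θ = (P.realKLD m θ : EReal) := by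
  rw [wKLD, realKLD, EReal.coe_finsetSum]
  refine Finset.sum_congr rfl fun z _ => ?_
  by_cases hm : m z = 0
  · simp [hm]
  rw [← Finset.sum_mul, EReal.coe_mul, EReal.coe_finsetSum]
  congr 1
  refine Finset.sum_congr rfl fun s' _ => ?_
  by_cases hQ : P.Q z s' = 0
  · simp [hQ]
  have hq := h z hm s' hQ
  have hQ' : 0 < P.Q z s' := (stdSimplex.zero_le _ _).lt_of_ne' hQ
  have hq' : 0 < P.Qsub θ z s' := (stdSimplex.zero_le _ _).lt_of_ne' hq
  rw [← ENNReal.ofReal_div_of_pos hq', ENNReal.log_ofReal_of_pos (div_pos hQ' hq'),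
    Real.log_div hQ hq, EReal.coe_mul]

/-- One infinite term decides the sum only if no term is `⊥`, as `⊤ + ⊥ = ⊥` in `EReal`. The
logarithm can be `⊥` only where the true probability is `0`, and there the factor `0` removes it. -/
theorem wKLD_eq_top {P : SMDP S X E} {m : stdSimplex ℝ (Gr P.Γ)} {θ : P.Θ}
    (h : ¬ P.IsAdmissible m θ) : P.wKLD m θ = ⊤ := by
  simp only [IsAdmissible, not_forall, exists_prop, not_not] at h
  obtain ⟨z, hm, s', hQ, hq⟩ := h
  have hpos : ∀ z s', P.Q z s' ≠ 0 → (0 : EReal) < (P.Q z s' : ℝ) := fun z s' h =>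
    EReal.coe_pos.2 ((stdSimplex.zero_le _ _).lt_of_ne' h)
  have hterm : ∀ z s', ((P.Q z s' : ℝ) : EReal) *
      ENNReal.log (ENNReal.ofReal (P.Q z s') / ENNReal.ofReal (P.Qsub θ z s')) ≠ ⊥ := by
    intro z s'
    by_cases hQ : P.Q z s' = 0
    · simp [hQ]
    · have hQ' : 0 < P.Q z s' := (stdSimplex.zero_le _ _).lt_of_ne' hQ
      have hlog : ENNReal.log (ENNReal.ofReal (P.Q z s') / ENNReal.ofReal (P.Qsub θ z s')) ≠ ⊥ := by
        rw [Ne, ENNReal.log_eq_bot_iff, ENNReal.div_eq_zero_iff]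
        simp [hQ']
      rw [Ne, EReal.mul_eq_bot]
      simp [hlog, hQ'.le, not_lt.2]
  have hinner : ∀ z, ∑ s', ((P.Q z s' : ℝ) : EReal) *
      ENNReal.log (ENNReal.ofReal (P.Q z s') / ENNReal.ofReal (P.Qsub θ z s')) ≠ ⊥ := fun z =>
    EReal.finsetSum_ne_bot fun s' _ => hterm z s'
  refine EReal.finsetSum_eq_top (fun z _ => ?_) (Finset.mem_univ z) ?_
  · rw [Ne, EReal.mul_eq_bot]
    have : ¬ ((m z : ℝ) : EReal) < 0 := not_lt.2 (EReal.coe_nonneg.2 (stdSimplex.zero_le _ _))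
    simp [hinner z, this]
  · have h1 : ∑ s', ((P.Q z s' : ℝ) : EReal) *
        ENNReal.log (ENNReal.ofReal (P.Q z s') / ENNReal.ofReal (P.Qsub θ z s')) = ⊤ := by
      refine EReal.finsetSum_eq_top (fun s' _ => hterm z s') (Finset.mem_univ s') ?_
      have hQ' : 0 < P.Q z s' := (stdSimplex.zero_le _ _).lt_of_ne' hQ
      rw [hq, ENNReal.ofReal_zero, ENNReal.div_zero (ENNReal.ofReal_pos.2 hQ').ne',
        ENNReal.log_top, EReal.mul_top_of_pos (hpos z s' hQ)]
    rw [h1, EReal.top_mul_of_pos]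
    exact EReal.coe_pos.2 ((stdSimplex.zero_le _ _).lt_of_ne' hm)

theorem truncKLD_le_realKLD {P : SMDP S X E} {m : stdSimplex ℝ (Gr P.Γ)} {θ : P.Θ}
    (h : P.IsAdmissible m θ) (ε : ℝ) : P.truncKLD ε m θ ≤ P.realKLD m θ := by
  refine Finset.sum_le_sum fun z _ => Finset.sum_le_sum fun s' _ => ?_
  by_cases hm : m z = 0
  · simp [hm]
  by_cases hQ : P.Q z s' = 0
  · simp [hQ]
  have hq' : 0 < P.Qsub θ z s' := (stdSimplex.zero_le _ _).lt_of_ne' (h z hm s' hQ)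
  refine mul_le_mul_of_nonneg_right (mul_le_mul_of_nonneg_left ?_ (stdSimplex.zero_le _ _))
    (stdSimplex.zero_le _ _)
  exact sub_le_sub_left (Real.log_le_log hq' (le_max_left _ _)) _

/-- Only finitely many positive subjective probabilities occur; any `ε` below all of them leaves the
relevant terms unchanged. -/
theorem exists_truncKLD_eq_realKLD {P : SMDP S X E} {m : stdSimplex ℝ (Gr P.Γ)} {θ : P.Θ}
    (h : P.IsAdmissible m θ) : ∃ ε > 0, P.truncKLD ε m θ = P.realKLD m θ := by
  have hev : ∀ᶠ ε : ℝ in 𝓝[>] 0, ∀ z s', 0 < P.Qsub θ z s' → ε < P.Qsub θ z s' := by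
    refine eventually_all.2 fun z => eventually_all.2 fun s' => ?_
    by_cases hq : 0 < P.Qsub θ z s'
    · filter_upwards [nhdsWithin_le_nhds (gt_mem_nhds hq)] with ε hε _ using hε
    · exact Eventually.of_forall fun ε h => absurd h hq
  obtain ⟨ε, hε, hε0⟩ := (hev.and self_mem_nhdsWithin).exists
  refine ⟨ε, hε0, Finset.sum_congr rfl fun z _ => Finset.sum_congr rfl fun s' _ => ?_⟩
  by_cases hm : m z = 0
  · simp [hm]
  by_cases hQ : P.Q z s' = 0
  · simp [hQ]
  rw [max_eq_left (hε z s' ((stdSimplex.zero_le _ _).lt_of_ne' (h z hm s' hQ))).le]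

theorem exists_le_truncKLD {P : SMDP S X E} {m : stdSimplex ℝ (Gr P.Γ)} {θ : P.Θ}
    (h : ¬ P.IsAdmissible m θ) (C : ℝ) : ∃ ε > 0, C ≤ P.truncKLD ε m θ := by
  simp only [IsAdmissible, not_forall, exists_prop, not_not] at h
  obtain ⟨z₀, hm, s₀, hQ, hq⟩ := h
  have hw : 0 < P.Q z₀ s₀ * m z₀ := mul_pos ((stdSimplex.zero_le _ _).lt_of_ne' hQ)
    ((stdSimplex.zero_le _ _).lt_of_ne' hm)
  set B := ∑ z, ∑ s', P.Q z s' * Real.log (P.Q z s') * m z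
  -- The vanishing probability contributes its weight times `T` at `ε = exp (-T)`, which makes up
  -- for `C - B`. Taking `T ≥ 0` keeps `ε ≤ 1`, so the remaining truncated terms are nonnegative.
  set T := max 0 ((C - B) / (P.Q z₀ s₀ * m z₀))
  have hT0 : 0 ≤ T := le_max_left _ _
  have hT : C - B ≤ P.Q z₀ s₀ * m z₀ * T := by
    rw [mul_comm]
    exact (div_le_iff₀ hw).1 (le_max_right _ _)
  refine ⟨Real.exp (-T), Real.exp_pos _, ?_⟩
  have hsplit : P.truncKLD (Real.exp (-T)) m θ = B + ∑ z, ∑ s',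
      P.Q z s' * m z * -Real.log (max (P.Qsub θ z s') (Real.exp (-T))) := by
    simp only [truncKLD, B, ← Finset.sum_add_distrib]
    exact Finset.sum_congr rfl fun z _ => Finset.sum_congr rfl fun s' _ => by ring
  have hnn : ∀ z s', 0 ≤ P.Q z s' * m z * -Real.log (max (P.Qsub θ z s') (Real.exp (-T))) := by
    intro z s'
    refine mul_nonneg (mul_nonneg (stdSimplex.zero_le _ _) (stdSimplex.zero_le _ _)) ?_
    refine neg_nonneg.2 (Real.log_nonpos ((Real.exp_pos _).le.trans (le_max_right _ _)) ?_)
    exact max_le (stdSimplex.le_one _ _) (Real.exp_le_one_iff.2 (neg_nonpos.2 hT0))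
  have h1 : P.Q z₀ s₀ * m z₀ * T ≤ ∑ z, ∑ s',
      P.Q z s' * m z * -Real.log (max (P.Qsub θ z s') (Real.exp (-T))) := by
    have h2 : P.Q z₀ s₀ * m z₀ * T
        = P.Q z₀ s₀ * m z₀ * -Real.log (max (P.Qsub θ z₀ s₀) (Real.exp (-T))) := by
      rw [hq, max_eq_right (Real.exp_pos _).le, Real.log_exp, neg_neg]
    rw [h2]
    exact (Finset.single_le_sum (fun s' _ => hnn z₀ s') (Finset.mem_univ s₀)).trans
      (Finset.single_le_sum (f := fun z => ∑ s',
        P.Q z s' * m z * -Real.log (max (P.Qsub θ z s') (Real.exp (-T))))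
        (fun z _ => Finset.sum_nonneg fun s' _ => hnn z s') (Finset.mem_univ z₀))
  rw [hsplit]
  linarith

/-- The weighted Kullback-Leibler divergence is the supremum of its truncations. -/
theorem wKLD_le_iff {P : SMDP S X E} {m : stdSimplex ℝ (Gr P.Γ)} {θ : P.Θ} {a : EReal} :
    P.wKLD m θ ≤ a ↔ ∀ ε > 0, (P.truncKLD ε m θ : EReal) ≤ a := by
  by_cases h : P.IsAdmissible m θ
  · rw [wKLD_eq_realKLD h]
    refine ⟨fun ha ε _ => (EReal.coe_le_coe_iff.2 (truncKLD_le_realKLD h ε)).trans ha,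
      fun ha => ?_⟩
    obtain ⟨ε, hε, he⟩ := exists_truncKLD_eq_realKLD h
    exact he ▸ ha ε hε
  · rw [wKLD_eq_top h, top_le_iff]
    refine ⟨fun ha ε _ => ha ▸ le_top, fun ha => ?_⟩
    refine EReal.eq_top_iff_forall_lt a |>.2 fun C => ?_
    obtain ⟨ε, hε, hC⟩ := exists_le_truncKLD h (C + 1)
    exact (EReal.coe_lt_coe_iff.2 ((lt_add_one C).trans_le hC)).trans_le (ha ε hε)

namespace IsRegular

variable {k : ℕ} {P : SMDP S X (EuclideanSpace ℝ (Fin k))}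

theorem continuous_truncKLD (hP : P.IsRegular) {ε : ℝ} (hε : 0 < ε) :
    Continuous fun p : stdSimplex ℝ (Gr P.Γ) × P.Θ => P.truncKLD ε p.1 p.2 := by
  refine continuous_finsetSum _ fun z _ => continuous_finsetSum _ fun s' _ => ?_
  refine (continuous_const.mul (continuous_const.sub (Continuous.log ?_ fun p => ?_))).mul
    ((stdSimplex.continuous_eval z).comp continuous_fst)
  · exact ((hP.continuous z s').comp continuous_snd).max continuous_const
  · exact (hε.trans_le (le_max_right _ _)).ne'

/-- Each sublevel set is an intersection of sublevel sets of the continuous truncations. -/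
theorem lowerSemicontinuous_wKLD (hP : P.IsRegular) (m : stdSimplex ℝ (Gr P.Γ)) :
    LowerSemicontinuous (P.wKLD m) := by
  rw [lowerSemicontinuous_iff_isClosed_preimage]
  intro a
  have hc : ∀ ε : Set.Ioi (0 : ℝ), Continuous fun θ => (P.truncKLD ε m θ : EReal) := by
    intro ε
    have h1 := (hP.continuous_truncKLD (Set.mem_Ioi.1 ε.2)).comp (Continuous.prodMk_right m)
    exact continuous_coe_real_ereal.comp h1
  have h : P.wKLD m ⁻¹' Set.Iic a = ⋂ ε : Set.Ioi (0 : ℝ),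
      (fun θ => (P.truncKLD ε m θ : EReal)) ⁻¹' Set.Iic a := by
    ext θ
    rw [Set.mem_iInter, Set.mem_preimage, Set.mem_Iic, wKLD_le_iff, Subtype.forall]
    simp only [Set.mem_preimage, Set.mem_Iic, Set.mem_Ioi, gt_iff_lt]
  exact h ▸ isClosed_iInter fun ε => isClosed_Iic.preimage (hc ε)

theorem closest_nonempty (hP : P.IsRegular) (m : stdSimplex ℝ (Gr P.Γ)) :
    (P.closest m).Nonempty := by
  have : CompactSpace P.Θ := isCompact_iff_compactSpace.1 hP.isCompact
  have : Nonempty P.Θ := P.Θ_nonempty.to_subtype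
  obtain ⟨θ, -, hθ⟩ := ((hP.lowerSemicontinuous_wKLD m).lowerSemicontinuousOn
    Set.univ).exists_isMinOn Set.univ_nonempty isCompact_univ
  exact ⟨θ, fun θ' => hθ (Set.mem_univ θ')⟩

/-- This turns minimality into inequalities between functions continuous in `(m, θ)`, from which the
closed graph follows. Competitors in `D` suffice: at an admissible `θ'` the real divergence is a
limit of its values along `D`, and at any other `θ'` the divergence is `⊤`. -/
theorem mem_closest_iff (hP : P.IsRegular) {D : Set P.Θ} (hD : Dense D)
    (hpos : ∀ θ ∈ D, ∀ z s', 0 < P.Q z s' → 0 < P.Qsub θ z s') {m : stdSimplex ℝ (Gr P.Γ)}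
    {θ : P.Θ} :
    θ ∈ P.closest m ↔ ∀ ε > 0, ∀ θ' ∈ D, P.truncKLD ε m θ ≤ P.realKLD m θ' := by
  have hadm : ∀ θ' ∈ D, P.IsAdmissible m θ' := fun θ' hθ' z _ s' hQ =>
    (hpos θ' hθ' z s' ((stdSimplex.zero_le _ _).lt_of_ne' hQ)).ne'
  constructor
  · intro h ε hε θ' hθ'
    have h1 := wKLD_le_iff.1 (h θ') ε hε
    rwa [wKLD_eq_realKLD (hadm θ' hθ'), EReal.coe_le_coe_iff] at h1
  · intro h θ'
    have hle : ∀ θ' ∈ D, P.wKLD m θ ≤ (P.realKLD m θ' : EReal) := fun θ' hθ' =>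
      wKLD_le_iff.2 fun ε hε => EReal.coe_le_coe_iff.2 (h ε hε θ' hθ')
    by_cases ha : P.IsAdmissible m θ'
    · rw [wKLD_eq_realKLD ha]
      have hc : ContinuousAt (P.realKLD m) θ' := by
        refine tendsto_finsetSum _ fun z _ => tendsto_finsetSum _ fun s' _ => ?_
        by_cases hm : m z = 0
        · simp [hm]
        by_cases hQ : P.Q z s' = 0
        · simp [hQ]
        · exact ((tendsto_const_nhds.sub ((hP.continuous z s').continuousAt.log
            (ha z hm s' hQ))).const_mul _).mul_const _
      have := mem_closure_iff_nhdsWithin_neBot.1 (hD θ')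
      refine ge_of_tendsto ((continuous_coe_real_ereal.continuousAt.comp hc).tendsto.mono_left
        (nhdsWithin_le_nhds (s := D))) ?_
      filter_upwards [self_mem_nhdsWithin] with θ'' hθ'' using hle θ'' hθ''
    · rw [wKLD_eq_top ha]
      exact le_top

/-- The correspondence of closest parameter values has a closed graph. -/
theorem isClosed_closest (hP : P.IsRegular) :
    IsClosed {p : stdSimplex ℝ (Gr P.Γ) × P.Θ | p.2 ∈ P.closest p.1} := by
  obtain ⟨D, hD, hpos⟩ := hP.dense
  simp only [hP.mem_closest_iff hD hpos, Set.ofPred_forall]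
  refine isClosed_iInter fun ε => isClosed_iInter fun hε => isClosed_iInter fun θ' =>
    isClosed_iInter fun _ => isClosed_le (hP.continuous_truncKLD hε) ?_
  refine continuous_finsetSum _ fun z _ => continuous_finsetSum _ fun s' _ => ?_
  exact continuous_const.mul ((stdSimplex.continuous_eval z).comp continuous_fst)

end IsRegular

end SMDP

/-! ### Continuity of values, optimality and stationarity in Markov decision processes -/

noncomputable section

namespace MDP

open Filter Topology

variable {S X : Type*} [Fintype S] [Fintype X]

theorem value_isBellmanSolution (M : MDP S X) : M.IsBellmanSolution M.value :=
  M.existsUnique_isBellmanSolution.choose_spec.1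

theorem actionValue_value_le (M : MDP S X) (z : Gr M.Γ) :
    M.actionValue M.value z ≤ M.value z.1.1 :=
  (M.value_isBellmanSolution z.1.1).2 ⟨z.1.2, z.2, rfl⟩

theorem exists_value_eq (M : MDP S X) (s : S) :
    ∃ z : Gr M.Γ, z.1.1 = s ∧ M.value s = M.actionValue M.value z := by
  obtain ⟨x, hx, h⟩ := (M.value_isBellmanSolution s).1
  exact ⟨⟨(s, x), hx⟩, rfl, h⟩

/-- The values of two MDPs that differ in the transition function only are close if the two
transition functions give similar expectations of one of the values. -/
theorem dist_value_le (M : MDP S X) (q q' : Gr M.Γ → stdSimplex ℝ S) :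
    dist (M.withTransition q').value (M.withTransition q).value ≤
      (1 - M.δ)⁻¹ * ∑ z : Gr M.Γ,
        |(M.withTransition q').actionValue (M.withTransition q).value z
          - (M.withTransition q).actionValue (M.withTransition q).value z| := by
  set V := (M.withTransition q).value with hV
  set V' := (M.withTransition q').value with hV'
  set e := ∑ z : Gr M.Γ, |(M.withTransition q').actionValue V z
    - (M.withTransition q).actionValue V z| with he
  have hez : ∀ z : Gr M.Γ, |(M.withTransition q').actionValue V z
      - (M.withTransition q).actionValue V z| ≤ e := fun z =>
    Finset.single_le_sum (f := fun z : Gr M.Γ => |(M.withTransition q').actionValue V z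
      - (M.withTransition q).actionValue V z|) (fun z _ => abs_nonneg _) (Finset.mem_univ z)
  have he0 : 0 ≤ e := Finset.sum_nonneg fun z _ => abs_nonneg _
  have hδ : 0 < 1 - M.δ := sub_pos.2 M.δ_lt_one
  -- At each state, the optimal action of one problem is used in the other; this costs the one-step
  -- error `e` plus the discounted distance of the continuation values, which is then absorbed on
  -- the left.
  have hd : dist V' V ≤ e + M.δ * dist V' V := by
    refine (dist_pi_le_iff (add_nonneg he0 (mul_nonneg M.δ_nonneg dist_nonneg))).2 fun s => ?_
    rw [Real.dist_eq, abs_le]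
    constructor
    · obtain ⟨z, rfl, hz⟩ := (M.withTransition q).exists_value_eq s
      have h1 := (M.withTransition q').actionValue_le_add V V' z
      have h2 := (M.withTransition q').actionValue_value_le z
      have h3 := (abs_le.1 (hez z)).1
      have h4 : (M.withTransition q').δ = M.δ := rfl
      rw [dist_comm V V', h4] at h1
      rw [← hV] at hz
      rw [← hV'] at h2
      linarith
    · obtain ⟨z, rfl, hz⟩ := (M.withTransition q').exists_value_eq s
      have h1 := (M.withTransition q').actionValue_le_add V' V z
      have h2 := (M.withTransition q).actionValue_value_le z
      have h3 := (abs_le.1 (hez z)).2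
      have h4 : (M.withTransition q').δ = M.δ := rfl
      rw [h4] at h1
      rw [← hV'] at hz
      rw [← hV] at h2
      linarith
  rw [inv_mul_eq_div, le_div_iff₀ hδ]
  linarith

theorem continuous_actionValue_withTransition (M : MDP S X) (z : Gr M.Γ) :
    Continuous fun p : (S → ℝ) × (Gr M.Γ → stdSimplex ℝ S) =>
      (M.withTransition p.2).actionValue p.1 z := by
  refine continuous_finsetSum _ fun s' _ => ?_
  refine (continuous_const.add (continuous_const.mul
    ((continuous_apply s').comp continuous_fst))).mul ?_
  exact (stdSimplex.continuous_eval s').comp ((continuous_apply z).comp continuous_snd)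

/-- The value function depends continuously on the transition function. -/
theorem continuous_value_withTransition (M : MDP S X) :
    Continuous fun q : Gr M.Γ → stdSimplex ℝ S => (M.withTransition q).value := by
  refine continuous_iff_continuousAt.2 fun q => tendsto_iff_dist_tendsto_zero.2 ?_
  refine squeeze_zero (fun _ => dist_nonneg) (fun q' => M.dist_value_le q q') ?_
  have hc : Continuous fun q' : Gr M.Γ → stdSimplex ℝ S => (1 - M.δ)⁻¹ * ∑ z : Gr M.Γ,
      |(M.withTransition q').actionValue (M.withTransition q).value z
        - (M.withTransition q).actionValue (M.withTransition q).value z| := by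
    refine continuous_const.mul (continuous_finsetSum _ fun z _ => ?_)
    have h := (M.continuous_actionValue_withTransition z).comp
      (Continuous.prodMk_right (M.withTransition q).value)
    exact (h.sub continuous_const).abs
  have h0 := hc.tendsto q
  simpa using h0

/-- The loss of value from the feasible pair `z` relative to an optimal action. -/
def slack (M : MDP S X) (z : Gr M.Γ) : ℝ := M.value z.1.1 - M.actionValue M.value z

theorem continuous_slack_withTransition (M : MDP S X) (z : Gr M.Γ) :
    Continuous fun q : Gr M.Γ → stdSimplex ℝ S => (M.withTransition q).slack z :=
  ((continuous_apply z.1.1).comp M.continuous_value_withTransition).sub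
    ((M.continuous_actionValue_withTransition z).comp
      (M.continuous_value_withTransition.prodMk continuous_id))

/-- Complementary slackness. In this form optimality is closed jointly in strategy and transition
function, and linear in the strategy for a fixed transition function. -/
theorem isOptimal_iff (M : MDP S X) (σ : M.Strategy) :
    M.IsOptimal σ ↔ ∀ z : Gr M.Γ, σ.1 z.1.1 z.1.2 * M.slack z = 0 := by
  constructor
  · rintro h ⟨⟨s, x⟩, hx⟩
    rcases (stdSimplex.zero_le (σ.1 s) x).eq_or_lt with h0 | h0
    · simp [← h0]
    · obtain ⟨hx', hmax⟩ := h s x h0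
      obtain ⟨⟨⟨_, y⟩, hy⟩, rfl, hv⟩ := M.exists_value_eq s
      refine mul_eq_zero_of_right _ (sub_eq_zero.2 ?_)
      exact le_antisymm (hv.le.trans (hmax y hy)) (M.actionValue_value_le ⟨_, hx⟩)
  · intro h s x hpos
    have hx : x ∈ M.Γ s := by
      by_contra hx
      exact hpos.ne' (σ.2 s x hx)
    refine ⟨hx, fun y hy => ?_⟩
    have h1 := (mul_eq_zero.1 (h ⟨(s, x), hx⟩)).resolve_left hpos.ne'
    exact (M.actionValue_value_le ⟨(s, y), hy⟩).trans (sub_eq_zero.1 h1).le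

theorem exists_isOptimal (M : MDP S X) : ∃ σ : M.Strategy, M.IsOptimal σ := by
  classical
  choose z hz hv using M.exists_value_eq
  have hΓ : ∀ s, (z s).1.2 ∈ M.Γ s := fun s => by
    have h : (z s).1.2 ∈ M.Γ (z s).1.1 := (z s).2
    rwa [hz] at h
  let σ : M.Strategy := ⟨fun s => ⟨Pi.single (z s).1.2 1, single_mem_stdSimplex ℝ _⟩, by
    intro s x hx
    exact Pi.single_eq_of_ne (fun h : x = (z s).1.2 => hx (h ▸ hΓ s)) _⟩
  refine ⟨σ, (M.isOptimal_iff σ).2 ?_⟩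
  rintro ⟨⟨s, x⟩, hx⟩
  by_cases hxz : x = (z s).1.2
  · refine mul_eq_zero_of_right _ (sub_eq_zero.2 ?_)
    have h1 : (⟨(s, x), hx⟩ : Gr M.Γ) = z s := Subtype.ext (Prod.ext (hz s).symm hxz)
    rw [h1, ← hv s, hz s]
  · exact mul_eq_zero_of_left (Pi.single_eq_of_ne hxz _) _

/-- Infeasible pairs have weight `0`, so summing over the graph loses nothing. This gives `push`
total mass `1`. -/
theorem sum_strategy_mul (M : MDP S X) (σ : M.Strategy) (w : S → ℝ) :
    ∑ z : Gr M.Γ, σ.1 z.1.1 z.1.2 * w z.1.1 = ∑ s, w s := by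
  classical
  have h1 := Finset.sum_subtype (F := Gr.fintype M.Γ)
    (Finset.univ.filter fun p : S × X => p ∈ Gr M.Γ)
    (p := fun p => p ∈ Gr M.Γ) (fun p => by simp) fun p => σ.1 p.1 p.2 * w p.1
  have h2 : ∑ p : S × X with p ∈ Gr M.Γ, σ.1 p.1 p.2 * w p.1
      = ∑ p : S × X, σ.1 p.1 p.2 * w p.1 := by
    refine Finset.sum_filter_of_ne fun p _ hp => ?_
    by_contra hΓ
    exact hp (mul_eq_zero_of_left (σ.2 p.1 p.2 hΓ) _)
  calc ∑ z : Gr M.Γ, σ.1 z.1.1 z.1.2 * w z.1.1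
      = ∑ p : S × X, σ.1 p.1 p.2 * w p.1 := h1.symm.trans h2
    _ = ∑ s, w s := by
      rw [Fintype.sum_prod_type]
      refine Finset.sum_congr rfl fun s _ =>
        (Finset.sum_mul Finset.univ (fun x => σ.1 s x) (w s)).symm.trans ?_
      exact (congrArg (· * w s) (stdSimplex.sum_eq_one (σ.1 s))).trans (one_mul _)

/-- The distribution of next period's state and action. -/
def push (M : MDP S X) (σ : M.Strategy) (m : stdSimplex ℝ (Gr M.Γ)) : stdSimplex ℝ (Gr M.Γ) :=
  ⟨fun z' => ∑ z, M.kernel σ z z' * m z,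
    fun z' => Finset.sum_nonneg fun z _ => mul_nonneg
      (mul_nonneg (stdSimplex.zero_le _ _) (stdSimplex.zero_le _ _)) (stdSimplex.zero_le _ _), by
      have h : ∀ z', ∑ z, M.kernel σ z z' * m z
          = σ.1 z'.1.1 z'.1.2 * ∑ z, M.Q z z'.1.1 * m z := fun z' => by
        simp only [kernel, Finset.mul_sum, mul_assoc]
      simp only [h]
      rw [M.sum_strategy_mul σ fun s => ∑ z, M.Q z s * m z, Finset.sum_comm]
      simp only [← Finset.sum_mul, stdSimplex.sum_eq_one, one_mul]⟩

end MDP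

/-! ### Barycenters, the equilibrium correspondence and its fixed point -/

namespace SMDP

open MeasureTheory

/-- A point of the convex hull of the image of `C` is a barycenter of a probability measure
concentrated on `C`. -/
theorem exists_probabilityMeasure_of_mem_convexHull {Ω ι κ : Type*} [MeasurableSpace Ω]
    [MeasurableSingletonClass Ω] {f : Ω → ι → κ → ℝ} {C : Set Ω}
    (hf : ∀ (μ : ProbabilityMeasure Ω) i j, Integrable (fun ω => f ω i j) (μ : Measure Ω))
    {q : ι → κ → ℝ} (hq : q ∈ convexHull ℝ (f '' C)) :
    ∃ μ : ProbabilityMeasure Ω, (∀ᵐ ω ∂(μ : Measure Ω), ω ∈ C) ∧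
      ∀ i j, ∫ ω, f ω i j ∂(μ : Measure Ω) = q i j := by
  -- The set of barycenters contains the image of `C` through Dirac measures, and is convex through
  -- mixtures.
  refine convexHull_min (t := {q | ∃ μ : ProbabilityMeasure Ω,
    (∀ᵐ ω ∂(μ : Measure Ω), ω ∈ C) ∧ ∀ i j, ∫ ω, f ω i j ∂(μ : Measure Ω) = q i j}) ?_ ?_ hq
  · rintro _ ⟨ω, hω, rfl⟩
    refine ⟨⟨Measure.dirac ω, inferInstance⟩, ?_, fun i j => ?_⟩
    · rw [ProbabilityMeasure.coe_mk, ae_dirac_eq]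
      exact hω
    · rw [ProbabilityMeasure.coe_mk, integral_dirac]
  · rintro q₁ ⟨μ, hμC, hμ⟩ q₂ ⟨ν, hνC, hν⟩ a b ha hb hab
    let ρ : Measure Ω := ENNReal.ofReal a • (μ : Measure Ω) + ENNReal.ofReal b • (ν : Measure Ω)
    have hρ : IsProbabilityMeasure ρ := ⟨by
      simp [ρ, ← ENNReal.ofReal_add ha hb, hab]⟩
    refine ⟨⟨ρ, hρ⟩, ?_, fun i j => ?_⟩
    · rw [ProbabilityMeasure.coe_mk]
      exact ae_add_measure_iff.2 ⟨Measure.ae_smul_measure hμC _, Measure.ae_smul_measure hνC _⟩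
    · rw [ProbabilityMeasure.coe_mk, integral_add_measure
        ((hf μ i j).smul_measure ENNReal.ofReal_ne_top)
        ((hf ν i j).smul_measure ENNReal.ofReal_ne_top), integral_smul_measure,
        integral_smul_measure, ENNReal.toReal_ofReal ha, ENNReal.toReal_ofReal hb, hμ, hν]
      rfl

end SMDP

namespace MDP

variable {S X : Type*} [Fintype S] [Fintype X]

/-- Strategies as real-valued functions. -/
def strategySet (M : MDP S X) : Set (S → X → ℝ) :=
  Set.univ.pi fun s => stdSimplex ℝ X ∩ {f | ∀ x ∉ M.Γ s, f x = 0}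

theorem isCompact_strategySet (M : MDP S X) : IsCompact M.strategySet := by
  refine isCompact_univ_pi fun s => (isCompact_stdSimplex ℝ X).inter_right ?_
  simp only [Set.ofPred_forall]
  exact isClosed_iInter fun x => isClosed_iInter fun _ =>
    isClosed_eq (continuous_apply x) continuous_const

theorem convex_strategySet (M : MDP S X) : Convex ℝ M.strategySet := by
  refine convex_pi fun s _ => (convex_stdSimplex ℝ X).inter ?_
  intro f hf g hg a b _ _ _ x hx
  simp [hf x hx, hg x hx]

theorem Strategy.mem_strategySet {M : MDP S X} (σ : M.Strategy) :
    (fun s x => σ.1 s x) ∈ M.strategySet :=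
  fun s _ => ⟨(σ.1 s).2, σ.2 s⟩

theorem exists_strategy_of_mem {M : MDP S X} {f : S → X → ℝ} (hf : f ∈ M.strategySet) :
    ∃ σ : M.Strategy, (fun s x => σ.1 s x) = f :=
  ⟨⟨fun s => ⟨f s, (hf s (Set.mem_univ s)).1⟩, fun s => (hf s (Set.mem_univ s)).2⟩, rfl⟩

end MDP

namespace SMDP

open MeasureTheory

variable {S X : Type*} [Fintype S] [Fintype X] {k : ℕ}

/-- The graph of the equilibrium correspondence, which sends a strategy `σ`, a distribution `m`
and a transition function `q` to an optimal strategy for `q`, the distribution of next period's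
state and action, and the transition function of a closest parameter value. -/
def equilibriumGraph (P : SMDP S X (EuclideanSpace ℝ (Fin k))) :
    Set (((S → X → ℝ) × (Gr P.Γ → ℝ) × (Gr P.Γ → S → ℝ)) ×
      ((S → X → ℝ) × (Gr P.Γ → ℝ) × (Gr P.Γ → S → ℝ))) :=
  {p | ∃ (σ σ' : P.toMDP.Strategy) (m : stdSimplex ℝ (Gr P.Γ)) (q : Gr P.Γ → stdSimplex ℝ S)
    (θ : P.Θ), (P.toMDP.withTransition q).IsOptimal σ' ∧ θ ∈ P.closest m ∧
      p = ((fun s x => σ.1 s x, fun z => m z, fun z s' => q z s'),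
        (fun s x => σ'.1 s x, fun z => P.toMDP.push σ m z, fun z s' => P.Qsub θ z s'))}

/-- The graph is the continuous image of a closed subset of a compact space, in which the parameter
`θ` itself is a coordinate. -/
theorem IsRegular.isCompact_equilibriumGraph {P : SMDP S X (EuclideanSpace ℝ (Fin k))}
    (hP : P.IsRegular) : IsCompact P.equilibriumGraph := by
  have : CompactSpace P.Θ := isCompact_iff_compactSpace.1 hP.isCompact
  let T := ((S → stdSimplex ℝ X) × stdSimplex ℝ (Gr P.Γ) × (Gr P.Γ → stdSimplex ℝ S)) ×
    ((S → stdSimplex ℝ X) × P.Θ)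
  let C₁ : Set T := {t | ∀ s x, x ∉ P.Γ s → t.1.1 s x = 0}
  let C₂ : Set T := {t | ∀ s x, x ∉ P.Γ s → t.2.1 s x = 0}
  let C₃ : Set T := {t | ∀ z : Gr P.Γ,
    t.2.1 z.1.1 z.1.2 * (P.toMDP.withTransition t.1.2.2).slack z = 0}
  let C₄ : Set T := {t | t.2.2 ∈ P.closest t.1.2.1}
  have heval : ∀ s x, Continuous fun σ : S → stdSimplex ℝ X => σ s x := fun s x =>
    (stdSimplex.continuous_eval x).comp (continuous_apply s)
  have hC₁ : IsClosed C₁ := by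
    simp only [C₁, Set.ofPred_forall]
    exact isClosed_iInter fun s => isClosed_iInter fun x => isClosed_iInter fun _ =>
      isClosed_eq ((heval s x).comp (continuous_fst.comp continuous_fst)) continuous_const
  have hC₂ : IsClosed C₂ := by
    simp only [C₂, Set.ofPred_forall]
    exact isClosed_iInter fun s => isClosed_iInter fun x => isClosed_iInter fun _ =>
      isClosed_eq ((heval s x).comp (continuous_fst.comp continuous_snd)) continuous_const
  have hC₃ : IsClosed C₃ := by
    simp only [C₃, Set.ofPred_forall]
    refine isClosed_iInter fun z => isClosed_eq (Continuous.mul ?_ ?_) continuous_const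
    · exact (heval z.1.1 z.1.2).comp (continuous_fst.comp continuous_snd)
    · exact (P.toMDP.continuous_slack_withTransition z).comp
        (continuous_snd.comp (continuous_snd.comp continuous_fst))
  have hC₄ : IsClosed C₄ := by
    have hc : Continuous fun t : T => (t.1.2.1, t.2.2) :=
      (continuous_fst.comp (continuous_snd.comp continuous_fst)).prodMk
        (continuous_snd.comp continuous_snd)
    exact hP.isClosed_closest.preimage hc
  have hC : IsCompact (C₁ ∩ C₂ ∩ C₃ ∩ C₄) :=
    (((hC₁.inter hC₂).inter hC₃).inter hC₄).isCompact
  let φ : T → ((S → X → ℝ) × (Gr P.Γ → ℝ) × (Gr P.Γ → S → ℝ)) ×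
      ((S → X → ℝ) × (Gr P.Γ → ℝ) × (Gr P.Γ → S → ℝ)) := fun t =>
    ((fun s x => t.1.1 s x, fun z => t.1.2.1 z, fun z s' => t.1.2.2 z s'),
      (fun s x => t.2.1 s x,
        fun z' => ∑ z, t.1.1 z'.1.1 z'.1.2 * P.Q z z'.1.1 * t.1.2.1 z,
        fun z s' => P.Qsub t.2.2 z s'))
  have hφ : Continuous φ := by
    have hσ : ∀ s x, Continuous fun t : T => t.1.1 s x := fun s x =>
      (heval s x).comp (continuous_fst.comp continuous_fst)
    have hσ' : ∀ s x, Continuous fun t : T => t.2.1 s x := fun s x =>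
      (heval s x).comp (continuous_fst.comp continuous_snd)
    have hm : ∀ z, Continuous fun t : T => t.1.2.1 z := fun z =>
      (stdSimplex.continuous_eval z).comp
        (continuous_fst.comp (continuous_snd.comp continuous_fst))
    have hq : ∀ z s', Continuous fun t : T => t.1.2.2 z s' := fun z s' =>
      (stdSimplex.continuous_eval s').comp ((continuous_apply z).comp
        (continuous_snd.comp (continuous_snd.comp continuous_fst)))
    have hθ : ∀ z s', Continuous fun t : T => P.Qsub t.2.2 z s' := fun z s' =>
      (hP.continuous z s').comp (continuous_snd.comp continuous_snd)
    refine Continuous.prodMk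
      ((continuous_pi fun s => continuous_pi fun x => hσ s x).prodMk
        ((continuous_pi fun z => hm z).prodMk
          (continuous_pi fun z => continuous_pi fun s' => hq z s')))
      ((continuous_pi fun s => continuous_pi fun x => hσ' s x).prodMk
        ((continuous_pi fun z' => continuous_finsetSum _ fun z _ => ?_).prodMk
          (continuous_pi fun z => continuous_pi fun s' => hθ z s')))
    exact ((hσ z'.1.1 z'.1.2).mul continuous_const).mul (hm z)
  have himg : P.equilibriumGraph = φ '' (C₁ ∩ C₂ ∩ C₃ ∩ C₄) := by
    ext p
    constructor
    · rintro ⟨σ, σ', m, q, θ, hσ', hθ, rfl⟩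
      exact ⟨((σ.1, m, q), (σ'.1, θ)), ⟨⟨⟨σ.2, σ'.2⟩,
        ((P.toMDP.withTransition q).isOptimal_iff σ').1 hσ'⟩, hθ⟩, rfl⟩
    · rintro ⟨⟨⟨σ, m, q⟩, σ', θ⟩, ⟨⟨⟨hσ, hσ'⟩, hopt⟩, hθ⟩, rfl⟩
      exact ⟨⟨σ, hσ⟩, ⟨σ', hσ'⟩, m, q, θ,
        ((P.toMDP.withTransition q).isOptimal_iff ⟨σ', hσ'⟩).2 hopt, hθ, rfl⟩
  rw [himg]
  exact hC.image hφ

theorem IsRegular.isCompact_closest {P : SMDP S X (EuclideanSpace ℝ (Fin k))}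
    (hP : P.IsRegular) (m : stdSimplex ℝ (Gr P.Γ)) : IsCompact (P.closest m) := by
  have : CompactSpace P.Θ := isCompact_iff_compactSpace.1 hP.isCompact
  exact (hP.isClosed_closest.preimage (Continuous.prodMk_right m)).isCompact

end SMDP

end

theorem theorem1 {S X : Type*} [Fintype S] [Nonempty S] [Fintype X] [Nonempty X] {k : ℕ}
    (P : SMDP S X (EuclideanSpace ℝ (Fin k))) (hP : P.IsRegular) :
    ∃ (σ : P.toMDP.Strategy) (m : stdSimplex ℝ (Gr P.Γ)), P.IsBerkNash σ m := by
  have : Nonempty (Gr P.Γ) := by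
    obtain ⟨s⟩ := ‹Nonempty S›
    obtain ⟨x, hx⟩ := P.Γ_nonempty s
    exact ⟨⟨(s, x), hx⟩⟩
  let K : Set ((S → X → ℝ) × (Gr P.Γ → ℝ) × (Gr P.Γ → S → ℝ)) :=
    P.toMDP.strategySet ×ˢ stdSimplex ℝ (Gr P.Γ) ×ˢ
      Set.univ.pi fun _ : Gr P.Γ => stdSimplex ℝ S
  have hKc : IsCompact K := P.toMDP.isCompact_strategySet.prod
    ((isCompact_stdSimplex ℝ _).prod (isCompact_univ_pi fun _ => isCompact_stdSimplex ℝ S))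
  have hK : Convex ℝ K := P.toMDP.convex_strategySet.prod
    ((convex_stdSimplex ℝ _).prod (convex_pi fun _ _ => convex_stdSimplex ℝ S))
  have hlift : ∀ v ∈ K, ∃ (σ : P.toMDP.Strategy) (m : stdSimplex ℝ (Gr P.Γ))
      (q : Gr P.Γ → stdSimplex ℝ S),
      v = (fun s x => σ.1 s x, fun z => m z, fun z s' => q z s') := by
    rintro ⟨f, m, q⟩ ⟨hf, hm, hq⟩
    obtain ⟨σ, rfl⟩ := MDP.exists_strategy_of_mem hf
    exact ⟨σ, ⟨m, hm⟩, fun z => ⟨q z, hq z (Set.mem_univ z)⟩, rfl⟩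
  have hKne : K.Nonempty := by
    obtain ⟨σ, -⟩ := P.toMDP.exists_isOptimal
    obtain ⟨m⟩ : Nonempty (stdSimplex ℝ (Gr P.Γ)) := inferInstance
    exact ⟨(fun s x => σ.1 s x, fun z => m z, fun z s' => P.Q z s'), σ.mem_strategySet, m.2,
      fun z _ => (P.Q z).2⟩
  obtain ⟨v, hv, hvG⟩ := exists_mem_closure_convexHull_of_isCompact hKc hK hKne
    hP.isCompact_equilibriumGraph
    (by
      rintro _ ⟨σ, σ', m, q, θ, -, -, rfl⟩
      exact ⟨σ'.mem_strategySet, (P.toMDP.push σ m).2, fun z _ => (P.Qsub θ z).2⟩)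
    (by
      intro v hv
      obtain ⟨σ, m, q, rfl⟩ := hlift v hv
      obtain ⟨σ', hσ'⟩ := (P.toMDP.withTransition q).exists_isOptimal
      obtain ⟨θ, hθ⟩ := hP.closest_nonempty m
      exact ⟨_, σ, σ', m, q, θ, hσ', hθ, rfl⟩)
  obtain ⟨σ, m, q, rfl⟩ := hlift v hv
  let W₁ : Set (S → X → ℝ) :=
    {f | ∀ z : Gr P.Γ, f z.1.1 z.1.2 * (P.toMDP.withTransition q).slack z = 0}
  let W₃ : Set (Gr P.Γ → S → ℝ) :=
    convexHull ℝ ((fun (θ : P.Θ) z s' => P.Qsub θ z s') '' P.closest m)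
  have hW₁ : IsClosed W₁ := by
    simp only [W₁, Set.ofPred_forall]
    refine isClosed_iInter fun z => isClosed_eq (Continuous.mul ?_ continuous_const)
      continuous_const
    exact (continuous_apply z.1.2).comp (continuous_apply z.1.1)
  have hW₁' : Convex ℝ W₁ := by
    intro f hf g hg a b _ _ _ z
    have h1 : (a • f + b • g) z.1.1 z.1.2 * (P.toMDP.withTransition q).slack z
        = a * (f z.1.1 z.1.2 * (P.toMDP.withTransition q).slack z)
          + b * (g z.1.1 z.1.2 * (P.toMDP.withTransition q).slack z) := by
      simp only [Pi.add_apply, Pi.smul_apply, smul_eq_mul]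
      ring
    rw [h1, hf z, hg z, mul_zero, mul_zero, add_zero]
  have hW₃ : IsClosed W₃ := by
    refine (((hP.isCompact_closest m).image ?_).isCompact_convexHull).isClosed
    exact continuous_pi fun z => continuous_pi fun s' => hP.continuous z s'
  -- A closed convex product containing the value at the fixed point. The distribution coordinate is
  -- a singleton because `push` uses the current `σ`, not the new optimal strategy; at the fixed
  -- point this is exactly stationarity.
  have hsub : closure (convexHull ℝ {y | ((fun s x => σ.1 s x, fun z => m z, fun z s' => q z s'),
      y) ∈ P.equilibriumGraph}) ⊆ W₁ ×ˢ {(fun z => P.toMDP.push σ m z)} ×ˢ W₃ := by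
    refine closure_minimal (convexHull_min ?_
      (hW₁'.prod ((convex_singleton _).prod (convex_convexHull ℝ _))))
      (hW₁.prod (isClosed_singleton.prod hW₃))
    rintro y ⟨σ₁, σ', m₁, q₁, θ, hσ', hθ, hy⟩
    simp only [Prod.mk.injEq] at hy
    obtain ⟨⟨h1, h2, h3⟩, rfl⟩ := hy
    have hσ : σ₁ = σ := Subtype.ext (funext fun s => stdSimplex.ext (congrFun h1 s).symm)
    have hm : m₁ = m := stdSimplex.ext h2.symm
    have hq : q₁ = q := funext fun z => stdSimplex.ext (congrFun h3 z).symm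
    subst hσ hm hq
    exact ⟨((P.toMDP.withTransition q₁).isOptimal_iff σ').1 hσ', rfl,
      subset_convexHull ℝ _ ⟨θ, hθ, rfl⟩⟩
  obtain ⟨hopt, hm, hq⟩ := hsub hvG
  -- The third coordinate becomes a belief on closest parameters whose mean transition is `q`, the
  -- transition function for which `σ` is optimal.
  obtain ⟨μ, hμC, hμ⟩ := SMDP.exists_probabilityMeasure_of_mem_convexHull
    (fun μ z s' => P.integrable_Qsub μ z s') hq
  have hmean : P.meanTransition μ = q :=
    funext fun z => stdSimplex.ext (funext fun s' => hμ z s')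
  refine ⟨σ, m, μ, ?_, hμC, fun z' => congrFun hm z'⟩
  rw [hmean]
  exact ((P.toMDP.withTransition q).isOptimal_iff σ).2 hopt
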